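/- **Setting.** Let $n_x,n_p\ge 0$ be integers, let $\mathcal X_p\subset\mathbb R^{n_p}$ and $\mathcal G_0\subset\mathbb R^{n_x}$ be non-empty and compact, and let $t^u>0$, $I=[0,t^u]$, $E=I\times\mathcal G_0\times\mathcal X_p$. Let $f:\mathbb R^{n_x}\times\mathcal X_p\to\mathbb R^{n_x}$ be globally Lipschitz, i.e. for some $M\ge 0$, $$\|f(x_1,p_1)-f(x_2,p_2)\|_2\le M\,\|[x_1,p_1]-[x_2,p_2]\|_2\qquad\text{for all }x_1,x_2\in\mathbb R^{n_x},\ p_1,p_2\in\mathcal X_p ,$$ and consider $\frac{dx}{dt}=f(x,p)$, $x(0)=x_0$. The flow map $\psi(t,x_0,p)$ is the value at time $t$ of the solution, defined for $t$ in the maximal interval of existence $I_{x_0;p}$. Let $\phi:\mathbb R\to\mathbb R$ be non-affine, Lipschitz continuous, and continuously differentiable at at least one point with nonzero derivative there. Let $\mathcal N^\phi_{a,b}$ be the class of functions $\mathbb R^a\to\mathbb R^b$ computed by feedforward networks with an arbitrary positive number of hidden layers, each having $a+b+2$ neurons with activation $\phi$, and with an affine output layer (identity activation). $\circ$ denotes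 the componentwise product of vectors. For $m\ge n_x$, a *decomposition* of $\psi$ is a tuple $(l,l^{-1},g,b,h)$ where $l:\mathbb R^{n_x}\to\mathbb R^m$ is continuous with a continuous left inverse $l^{-1}:\mathrm{Range}(l)\to\mathbb R^{n_x}$; $g,b:\mathcal G_0\times\mathcal X_p\to\mathbb R^m$ and $h:E\to\mathbb R^m$ are continuous; no component of $b$ vanishes anywhere on $\mathcal G_0\times\mathcal X_p$; and for all $(t,x_0,p)\in E$ one has $g(x_0,p)+h(t,x_0,p)\circ b(x_0,p)\in\mathrm{Range}(l)$ and $$\psi(t,x_0,p)=l^{-1}\big(g(x_0,p)+h(t,x_0,p)\circ b(x_0,p)\big).$$ **Theorem (universal approximation for LiLaN).** For all $x_0\in\mathbb R^{n_x}$ and $p\in\mathcal X_p$ one has $I_{x_0;p}=\mathbb R$, and the flow map $\psi$ exists. For every $m\ge n_x$, a decomposition of $\psi$ exists, and for every decomposition $(l,l^{-1},g,b,h)$ and every $\varepsilon>0$ there are networks $$d\in\mathcal N^\phi_{m,n_x},\qquad e,c\in\mathcal N^\phi_{n_x+n_p,m},\qquad \tau\in\mathcal N^\phi_{1+n_x+n_p,m}$$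 such that, with the latent state $y(s)=e(x_0,p)+s\circ c(x_0,p)$, $s\in\mathbb R^m$, which solves the latent dynamics $\partial y_i/\partial s_i=c_i(x_0,p)$ for all $i$, $y(0)=e(x_0,p)$, $$\sup_{(t,x_0,p)\in E}\big\|\psi(t,x_0,p)-d\big(e(x_0,p)+\tau(t,x_0,p)\circ c(x_0,p)\big)\big\|_2\le\varepsilon .$$ Moreover, $d$ is Lipschitz with a constant $L>0$ such that, with $c_1=\sup_{\mathcal G_0\times\mathcal X_p}\|b\|_\infty$ and $c_2=\sup_{E}\|\tau\|_\infty$ (both finite, and positive when $m\ge1$), the following bounds hold: $$\sup_{E}\big\|l^{-1}(g+h\circ b)-d(g+h\circ b)\big\|_2\le\frac{\varepsilon}{4},\qquad \sup_{\mathcal G_0\times\mathcal X_p}\|g-e\|_2\le\frac{\varepsilon}{4L},$$ $$\sup_{\mathcal G_0\times\mathcal X_p}\|b-c\|_2\le\frac{\varepsilon}{4Lc_2},\qquad \sup_{E}\|h-\tau\|_2\le\frac{\varepsilon}{4Lc_1}$$ (for $m=0$ the last two left-hand sides are $0$ and the two bounds are void). In particular, the required latent dimension $m$ does not depend on $\varepsilon$.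 -/

import Mathlib

open Set Filter Topology
open scoped Matrix

namespace LiLaN

/-- `Vec n` is `ℝⁿ` with the Euclidean norm. -/
abbrev Vec (n : ℕ) : Type := EuclideanSpace ℝ (Fin n)

/-- The concatenated vector `[x, p]`. -/
def join {a b : ℕ} (x : Vec a) (p : Vec b) : Vec (a + b) :=
  WithLp.toLp 2 (Fin.append x.ofLp p.ofLp)

/-- The concatenated vector `[t, x, p]`. -/
def joinTime {a b : ℕ} (t : ℝ) (x : Vec a) (p : Vec b) : Vec (a + b + 1) :=
  WithLp.toLp 2 (Fin.cons t (Fin.append x.ofLp p.ofLp))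

/-- The Hadamard (componentwise) product. -/
def hadamard {m : ℕ} (u v : Vec m) : Vec m :=
  WithLp.toLp 2 (fun i => u i * v i)

/-! ### The parametrized differential equation and its flow map -/

/-- `f` is globally Lipschitz jointly in the state and in the parameter `p ∈ Xp`. -/
def GloballyLipschitz {nx np : ℕ} (f : Vec nx → Vec np → Vec nx) (Xp : Set (Vec np)) : Prop :=
  ∃ M : ℝ, 0 ≤ M ∧ ∀ x₁ x₂ : Vec nx, ∀ p₁ ∈ Xp, ∀ p₂ ∈ Xp,
    ‖f x₁ p₁ - f x₂ p₂‖ ≤ M * ‖join x₁ p₁ - join x₂ p₂‖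

/-- On the open interval `J ∋ 0`, the curve `x` solves `dx/dt = f(x, p)`, `x(0) = x₀`. -/
def IsSolutionOn {nx np : ℕ} (f : Vec nx → Vec np → Vec nx) (p : Vec np) (x₀ : Vec nx)
    (J : Set ℝ) (x : ℝ → Vec nx) : Prop :=
  IsOpen J ∧ J.OrdConnected ∧ (0 : ℝ) ∈ J ∧ x 0 = x₀ ∧
    ∀ t ∈ J, HasDerivAt x (f (x t) p) t

/-- The maximal interval of existence: the union of all open intervals around `0` that carry a
solution of the initial value problem. -/
def maximalInterval {nx np : ℕ} (f : Vec nx → Vec np → Vec nx) (p : Vec np) (x₀ : Vec nx) :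
    Set ℝ :=
  ⋃₀ {J : Set ℝ | ∃ x : ℝ → Vec nx, IsSolutionOn f p x₀ J x}

/-- `ψ` is the flow map: for every initial state and every parameter in `Xp`, `t ↦ ψ t x₀ p` is
the solution of the initial value problem on its maximal interval of existence. (Values of `ψ`
outside these intervals, and for parameters outside `Xp`, are irrelevant.) -/
def IsFlowMap {nx np : ℕ} (f : Vec nx → Vec np → Vec nx) (Xp : Set (Vec np))
    (ψ : ℝ → Vec nx → Vec np → Vec nx) : Prop :=
  ∀ x₀ : Vec nx, ∀ p ∈ Xp,
    IsSolutionOn f p x₀ (maximalInterval f p x₀) (fun t => ψ t x₀ p)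

/-! ### Neural networks -/

/-- Admissible activation functions: non-affine, Lipschitz, and continuously differentiable at
some point with a nonzero derivative there. -/
def IsActivation (φ : ℝ → ℝ) : Prop :=
  (¬ ∃ α β : ℝ, ∀ s, φ s = α * s + β) ∧ (∃ K : NNReal, LipschitzWith K φ) ∧
    ∃ z : ℝ, (∀ᶠ s in 𝓝 z, DifferentiableAt ℝ φ s) ∧ ContinuousAt (deriv φ) z ∧ deriv φ z ≠ 0

/-- The maps `ℝᵃ → ℝʷ` computed by the last hidden layer of a feedforward network with input
dimension `a`, a positive number of hidden layers, each of `w` neurons, and activation `φ`. -/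
inductive HiddenLayers (φ : ℝ → ℝ) (a w : ℕ) : ((Fin a → ℝ) → (Fin w → ℝ)) → Prop
  | first (W : Matrix (Fin w) (Fin a) ℝ) (β : Fin w → ℝ) :
      HiddenLayers φ a w (fun x i => φ ((W *ᵥ x + β) i))
  | next (F : (Fin a → ℝ) → (Fin w → ℝ)) (hF : HiddenLayers φ a w F)
      (W : Matrix (Fin w) (Fin w) ℝ) (β : Fin w → ℝ) :
      HiddenLayers φ a w (fun x i => φ ((W *ᵥ F x + β) i))

/-- The class of deep narrow networks `ℝᵃ → ℝᵇ`: every hidden layer has `a + b + 2` neurons with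
activation `φ`, and the output layer is affine (identity activation). -/
def NetClass (φ : ℝ → ℝ) (a b : ℕ) : Set (Vec a → Vec b) :=
  {N | ∃ F : (Fin a → ℝ) → (Fin (a + b + 2) → ℝ), HiddenLayers φ a (a + b + 2) F ∧
    ∃ (A : Matrix (Fin b) (Fin (a + b + 2)) ℝ) (γ : Fin b → ℝ),
      N = fun x => WithLp.toLp 2 (A *ᵥ F x.ofLp + γ)}

/-! ### The latent dynamics -/

/-- `y` solves the latent dynamics `diag (dy/ds) = v`, `y(0) = y₀`, where `s` is the
vector-valued latent time: `∂yᵢ/∂sᵢ = vᵢ` for every `i`. -/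
def IsLatentSolution {m : ℕ} (v y₀ : Vec m) (y : Vec m → Vec m) : Prop :=
  y 0 = y₀ ∧ ∀ (s : Vec m) (i : Fin m),
    HasDerivAt (fun r : ℝ => y (WithLp.toLp 2 (Function.update s.ofLp i r)) i) (v i) (s i)

/-- The latent state `y₀ + s ∘ v` at latent time `s`. -/
def latentState {m : ℕ} (y₀ v s : Vec m) : Vec m :=
  y₀ + hadamard s v

/-! ### Decompositions of the flow map -/

/-- A decomposition `ψ = l⁻¹(g + h ∘ b)` of the flow map on `[0, T] × G₀ × Xp`. The map `linv` is
total, but only its values on `range l` matter. -/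
structure IsDecomposition {nx np m : ℕ} (T : ℝ) (G₀ : Set (Vec nx)) (Xp : Set (Vec np))
    (ψ : ℝ → Vec nx → Vec np → Vec nx)
    (l : Vec nx → Vec m) (linv : Vec m → Vec nx)
    (g b : Vec nx → Vec np → Vec m) (h : ℝ → Vec nx → Vec np → Vec m) : Prop where
  continuous_l : Continuous l
  leftInverse : Function.LeftInverse linv l
  continuousOn_linv : ContinuousOn linv (range l)
  continuousOn_g : ContinuousOn (fun q : Vec nx × Vec np => g q.1 q.2) (G₀ ×ˢ Xp)
  continuousOn_b : ContinuousOn (fun q : Vec nx × Vec np => b q.1 q.2) (G₀ ×ˢ Xp)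
  b_ne_zero : ∀ x ∈ G₀, ∀ p ∈ Xp, ∀ i, b x p i ≠ 0
  continuousOn_h : ContinuousOn (fun q : ℝ × Vec nx × Vec np => h q.1 q.2.1 q.2.2)
    (Icc 0 T ×ˢ G₀ ×ˢ Xp)
  mem_range : ∀ t ∈ Icc 0 T, ∀ x ∈ G₀, ∀ p ∈ Xp, g x p + hadamard (h t x p) (b x p) ∈ range l
  eq_flow : ∀ t ∈ Icc 0 T, ∀ x ∈ G₀, ∀ p ∈ Xp,
    ψ t x p = linv (g x p + hadamard (h t x p) (b x p))

end LiLaN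

/-! There are three ingredients: the flow map is continuous on the compact set `E`, deep narrow
networks approximate continuous functions uniformly on compact sets, and each such network is
Lipschitz.

Approximation. Mollifications of `φ` are locally uniform limits of combinations of its dilates and
translates. If all smooth limits of this kind had vanishing `n`-th derivative, each mollification
would be affine, since its derivative is bounded (`φ` is Lipschitz), and so `φ` would be affine.
Hence derivatives of every order survive, Taylor expansion produces all monomials, and Weierstrass
gives every continuous function of one variable (`mem_locClosure_ridgeSpan`). Exponentials `exp (w ⬝
x)` and Stone–Weierstrass lift this to several variables. A shallow network is then made narrow by
laying its neurons out in depth: each layer carries the input and a partial sum through nearly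
linear neurons and adds one ridge term (`Realizable.add_ridge`), which gives
`exists_netClass_approx`.

Flow. Truncating the vector field makes Picard–Lindelöf applicable on any prescribed interval, and
Gronwall shows that the truncation is never felt. A second use of Gronwall gives continuity in the
initial value and the parameter (`IsFlowMap.continuousOn`).

Error estimate. With `y = g + h ∘ b`, the latent error is `(g - e) + (h - τ) ∘ b + (b - c) ∘ τ`. The
networks are chosen in the order `d`, `e`, `τ`, `c`, because the tolerances depend on the Lipschitz
constant of `d`, on the bound for `b`, and on the bound for the already chosen `τ`. Each of the four
errors contributes at most `ε / 4` (`IsDecomposition.exists_networks`). -/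

namespace LiLaN

/-! ### Density of dilates and translates in one variable -/

/-- The functions on `ℝ` which are limits of elements of `S`, uniformly on bounded sets. -/
def locClosure (S : Submodule ℝ (ℝ → ℝ)) : Submodule ℝ (ℝ → ℝ) where
  carrier := {u | ∀ R ε : ℝ, 0 < ε → ∃ s ∈ S, ∀ t, |t| ≤ R → |u t - s t| ≤ ε}
  zero_mem' := fun R ε hε => ⟨0, S.zero_mem, fun t _ => by simpa using hε.le⟩
  add_mem' := by
    intro u v hu hv R ε hε
    obtain ⟨s, hs, h1⟩ := hu R (ε / 2) (by positivity)
    obtain ⟨r, hr, h2⟩ := hv R (ε / 2) (by positivity)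
    refine ⟨s + r, S.add_mem hs hr, fun t ht => ?_⟩
    have e : (u + v) t - (s + r) t = (u t - s t) + (v t - r t) := by
      simp only [Pi.add_apply]; ring
    rw [e]
    linarith [abs_add_le (u t - s t) (v t - r t), h1 t ht, h2 t ht]
  smul_mem' := by
    intro c u hu R ε hε
    obtain ⟨s, hs, h1⟩ := hu R (ε / (|c| + 1)) (by positivity)
    refine ⟨c • s, S.smul_mem c hs, fun t ht => ?_⟩
    have e : (c • u) t - (c • s) t = c * (u t - s t) := by
      simp only [Pi.smul_apply, smul_eq_mul]; ring
    rw [e, abs_mul]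
    calc |c| * |u t - s t| ≤ (|c| + 1) * (ε / (|c| + 1)) := by
          gcongr
          · linarith
          · exact h1 t ht
      _ = ε := by field_simp

theorem mem_locClosure_of_approx {S : Submodule ℝ (ℝ → ℝ)} {u : ℝ → ℝ}
    (h : ∀ R ε : ℝ, 0 < ε → ∃ s ∈ locClosure S, ∀ t, |t| ≤ R → |u t - s t| ≤ ε) :
    u ∈ locClosure S := by
  intro R ε hε
  obtain ⟨s, hs, h1⟩ := h R (ε / 2) (by positivity)
  obtain ⟨r, hr, h2⟩ := hs R (ε / 2) (by positivity)
  refine ⟨r, hr, fun t ht => ?_⟩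
  linarith [abs_sub_le (u t) (s t) (r t), h1 t ht, h2 t ht]

/-- The span of the dilates and translates of `φ`. -/
def ridgeSpan (φ : ℝ → ℝ) : Submodule ℝ (ℝ → ℝ) :=
  Submodule.span ℝ (range fun q : ℝ × ℝ => fun t => φ (q.1 * t + q.2))

theorem ridgeSpan_comp_affine {φ u : ℝ → ℝ} (hu : u ∈ ridgeSpan φ) (w b : ℝ) :
    (fun t => u (w * t + b)) ∈ ridgeSpan φ := by
  induction hu using Submodule.span_induction with
  | mem u h =>
    obtain ⟨q, rfl⟩ := h
    refine Submodule.subset_span ⟨(q.1 * w, q.1 * b + q.2), ?_⟩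
    funext t
    simp only
    ring_nf
  | zero => exact (ridgeSpan φ).zero_mem
  | add u v _ _ h1 h2 => exact (ridgeSpan φ).add_mem h1 h2
  | smul c u _ h => exact (ridgeSpan φ).smul_mem c h

theorem locClosure_comp_affine {φ u : ℝ → ℝ} (hu : u ∈ locClosure (ridgeSpan φ)) (w b : ℝ) :
    (fun t => u (w * t + b)) ∈ locClosure (ridgeSpan φ) := by
  intro R ε hε
  obtain ⟨s, hs, h⟩ := hu (|w| * R + |b|) ε hε
  refine ⟨_, ridgeSpan_comp_affine hs w b, fun t ht => h _ ?_⟩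
  calc |w * t + b| ≤ |w| * |t| + |b| := by rw [← abs_mul]; exact abs_add_le _ _
    _ ≤ _ := by gcongr

/-- If a smooth function has a nonzero `k`-th derivative somewhere, its dilates and translates
approximate `t ^ k`, modulo lower powers. -/
theorem pow_mem_locClosure_step {φ f : ℝ → ℝ} {k : ℕ} {b : ℝ} (hf : ContDiff ℝ k f)
    (hfV : f ∈ locClosure (ridgeSpan φ)) (hb : iteratedDeriv k f b ≠ 0)
    (hlow : ∀ j < k, (fun t : ℝ => t ^ j) ∈ locClosure (ridgeSpan φ)) :
    (fun t : ℝ => t ^ k) ∈ locClosure (ridgeSpan φ) := by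
  apply mem_locClosure_of_approx
  intro R ε hε
  -- `A` is the leading Taylor coefficient. The dilation `w` is so small that `w * t` stays in the
  -- Taylor ball for `|t| ≤ R'`; dividing the remainder, at most `|A| * ε / R' ^ k * |w * t| ^ k`,
  -- by `A * w ^ k` leaves at most `ε`.
  set A : ℝ := iteratedDeriv k f b / (Nat.factorial k : ℝ) with hA
  have hA0 : A ≠ 0 := div_ne_zero hb (by positivity)
  set R' : ℝ := |R| + 1
  have hR' : 0 < R' := by positivity
  have ho := (taylor_isLittleO_univ (x₀ := b) hf).def
    (c := |A| * ε / R' ^ k) (by positivity)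
  obtain ⟨δ, hδ, hball⟩ := Metric.eventually_nhds_iff.1 ho
  set w : ℝ := δ / (2 * R')
  have hw : 0 < w := by positivity
  have hT : ∀ t : ℝ, taylorWithinEval f k univ b (w * t + b) =
      (∑ j ∈ Finset.range k, ((Nat.factorial j : ℝ)⁻¹ * w ^ j * iteratedDeriv j f b) * t ^ j)
        + A * w ^ k * t ^ k := by
    intro t
    rw [taylor_within_apply, Finset.sum_range_succ]
    simp only [iteratedDerivWithin_univ, add_sub_cancel_right, smul_eq_mul, mul_pow, hA]
    congr 1
    · refine Finset.sum_congr rfl fun j _ => by ring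
    · ring
  refine ⟨(A * w ^ k)⁻¹ • ((fun t => f (w * t + b)) - ∑ j ∈ Finset.range k,
    ((Nat.factorial j : ℝ)⁻¹ * w ^ j * iteratedDeriv j f b) • (fun t : ℝ => t ^ j)), ?_, ?_⟩
  · refine Submodule.smul_mem _ _ (Submodule.sub_mem _ (locClosure_comp_affine hfV w b) ?_)
    exact Submodule.sum_mem _ fun j hj =>
      Submodule.smul_mem _ _ (hlow j (Finset.mem_range.1 hj))
  · intro t ht
    have htR : |t| ≤ R' := ht.trans (by linarith [le_abs_self R])
    have hd : dist (w * t + b) b < δ := by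
      rw [Real.dist_eq, add_sub_cancel_right, abs_mul, abs_of_pos hw]
      calc w * |t| ≤ w * R' := by gcongr
        _ = δ / 2 := by simp only [w]; field_simp
        _ < δ := by linarith
    have h1 := hball hd
    rw [hT t, add_sub_cancel_right] at h1
    simp only [Real.norm_eq_abs] at h1
    have hAw : A * w ^ k ≠ 0 := mul_ne_zero hA0 (by positivity)
    simp only [Pi.smul_apply, Pi.sub_apply, Finset.sum_apply, smul_eq_mul]
    set Q := ∑ j ∈ Finset.range k, ((Nat.factorial j : ℝ)⁻¹ * w ^ j * iteratedDeriv j f b) * t ^ j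
    have e : t ^ k - (A * w ^ k)⁻¹ * (f (w * t + b) - Q) =
        -((A * w ^ k)⁻¹ * (f (w * t + b) - (Q + A * w ^ k * t ^ k))) := by
      field_simp
      ring
    rw [e, abs_neg, abs_mul, abs_inv, abs_mul, abs_of_pos (pow_pos hw k)]
    calc (|A| * w ^ k)⁻¹ * |f (w * t + b) - (Q + A * w ^ k * t ^ k)|
        ≤ (|A| * w ^ k)⁻¹ * (|A| * ε / R' ^ k * |(w * t) ^ k|) := by gcongr
      _ = ε * (|t| / R') ^ k := by
          rw [abs_pow, abs_mul, abs_of_pos hw, mul_pow]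
          have : |A| ≠ 0 := abs_ne_zero.2 hA0
          field_simp
          rw [div_pow]
          field_simp
      _ ≤ ε * 1 := by
          gcongr
          exact pow_le_one₀ (by positivity) ((div_le_one hR').2 htR)
      _ = ε := mul_one ε

/-- A bounded smooth function with a vanishing derivative of some order is constant. -/
theorem eq_const_of_bounded_of_iteratedDeriv_eq_zero (k : ℕ) :
    ∀ v : ℝ → ℝ, ContDiff ℝ (⊤ : ℕ∞) v → (∃ C, ∀ t, |v t| ≤ C) → (∀ t, iteratedDeriv k v t = 0) →
      ∀ s t, v s = v t := by
  induction k with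
  | zero => intro v _ _ h s t; simp only [iteratedDeriv_zero] at h; rw [h, h]
  | succ k ih =>
    rintro v hv ⟨C, hC⟩ h
    -- The `k`-th derivative of `v` is constant, so increments of `v` by a fixed step are bounded
    -- with vanishing `k`-th derivative, hence constant by induction. Then `v` grows linearly along
    -- multiples of the step, and boundedness forces the growth to be zero.
    have key : ∀ h' s t, v (s + h') - v s = v (t + h') - v t := by
      intro h'
      have hv' : ContDiff ℝ (⊤ : ℕ∞) (fun t => v (t + h')) := hv.comp (by fun_prop)
      refine ih (fun t => v (t + h') - v t) (hv'.sub hv) ⟨C + C, fun t => ?_⟩ fun t => ?_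
      · exact (abs_sub _ _).trans (add_le_add (hC _) (hC _))
      · have hd : Differentiable ℝ (iteratedDeriv k v) :=
          hv.differentiable_iteratedDeriv k (by exact_mod_cast WithTop.coe_lt_top k)
        have hc : iteratedDeriv k v (t + h') = iteratedDeriv k v t :=
          is_const_of_deriv_eq_zero hd (fun x => by rw [← iteratedDeriv_succ]; exact h x) _ _
        have hk : ((k : ℕ∞) : WithTop ℕ∞) ≤ ((⊤ : ℕ∞) : WithTop ℕ∞) := by exact_mod_cast le_top
        have := iteratedDeriv_fun_sub (n := k) (x := t) (hv'.contDiffAt.of_le hk)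
          (hv.contDiffAt.of_le hk)
        rw [this, iteratedDeriv_comp_add_const]; exact sub_eq_zero.2 hc
    have hlin : ∀ h' : ℝ, ∀ n : ℕ, v (n * h') = v 0 + n * (v h' - v 0) := by
      intro h' n
      induction n with
      | zero => simp
      | succ n ihn =>
        have := key h' (n * h') 0
        rw [zero_add] at this
        push_cast
        rw [add_mul, one_mul]
        linarith
    have h0 : ∀ h', v h' = v 0 := by
      intro h'
      by_contra hne
      have hpos : 0 < |v h' - v 0| := abs_pos.2 (sub_ne_zero.2 hne)
      obtain ⟨n, hn⟩ := exists_nat_gt ((C + C) / |v h' - v 0|)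
      rw [div_lt_iff₀ hpos] at hn
      have h1 : (n : ℝ) * |v h' - v 0| = |v (n * h') - v 0| := by
        rw [hlin h' n, add_sub_cancel_left, abs_mul, Nat.abs_cast]
      have h2 := (abs_sub (v (n * h')) (v 0)).trans (add_le_add (hC _) (hC _))
      linarith
    intro s t
    rw [h0 s, h0 t]

/-- A closed subspace of a complete space is complete, so the integral can be formed inside `W`; the
inclusion commutes with it. -/
theorem integral_mem_of_isClosed {X : Type*} [NormedAddCommGroup X] [NormedSpace ℝ X]
    [CompleteSpace X] (W : Submodule ℝ X) (hW : IsClosed (W : Set X)) {f : ℝ → X}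
    (hf : Continuous f) (hfc : HasCompactSupport f) (hfW : ∀ y, f y ∈ W) : (∫ y, f y) ∈ W := by
  have := hW.completeSpace_coe
  let f' : ℝ → W := fun y => ⟨f y, hfW y⟩
  have hf' : Continuous f' := hf.subtype_mk hfW
  have hfc' : HasCompactSupport f' := by
    refine HasCompactSupport.intro hfc fun x hx => ?_
    exact Subtype.ext (image_eq_zero_of_notMem_tsupport (f := f) hx)
  have h := W.subtypeL.integral_comp_comm (hf'.integrable_of_hasCompactSupport hfc'
    (μ := MeasureTheory.volume))
  have h' : (∫ y, f y) = W.subtypeL (∫ y, f' y) := h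
  rw [h']
  exact Subtype.mem _

/-- The restrictions to `J` of the elements of `U`, as far as they are continuous. -/
def restrictSubmodule {X : Type*} [TopologicalSpace X] (J : Set X) (U : Submodule ℝ (X → ℝ)) :
    Submodule ℝ C(J, ℝ) where
  carrier := {g | ∃ u ∈ U, ∀ t, g t = u t}
  zero_mem' := ⟨0, Submodule.zero_mem _, fun _ => rfl⟩
  add_mem' := by
    rintro g g' ⟨u, hu, h⟩ ⟨u', hu', h'⟩
    exact ⟨u + u', Submodule.add_mem _ hu hu', fun t => by simp [h, h']⟩
  smul_mem' := by
    rintro c g ⟨u, hu, h⟩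
    exact ⟨c • u, Submodule.smul_mem _ c hu, fun t => by simp [h]⟩

/-- On `[-R, R]` the convolution is a Bochner integral in the space of continuous functions. Its
integrand takes values in the restricted ridge span, so the integral lies in the closure of that
span. -/
theorem integral_mul_comp_sub_mem_locClosure {φ k : ℝ → ℝ} (hφ : Continuous φ) (hk : Continuous k)
    (hkc : HasCompactSupport k) :
    (fun x => ∫ y, k y * φ (x - y)) ∈ locClosure (ridgeSpan φ) := by
  intro R ε hε
  let J := Icc (-R) R
  let F : C(ℝ, C(J, ℝ)) := ContinuousMap.curry ⟨fun q : ℝ × J => φ (q.2 - q.1), by fun_prop⟩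
  let S : Submodule ℝ C(J, ℝ) := restrictSubmodule J (ridgeSpan φ)
  have hFS : ∀ y, F y ∈ S := fun y =>
    ⟨_, Submodule.subset_span ⟨(1, -y), rfl⟩, fun t => by simp [F, sub_eq_add_neg]⟩
  have hcont : Continuous fun y => k y • F y := hk.smul F.continuous
  have hint : MeasureTheory.Integrable (fun y => k y • F y) :=
    hcont.integrable_of_hasCompactSupport hkc.smul_right
  have hmem : (∫ y, k y • F y) ∈ S.topologicalClosure := by
    refine integral_mem_of_isClosed _ S.isClosed_topologicalClosure hcont hkc.smul_right
      fun y => Submodule.smul_mem _ _ (S.le_topologicalClosure (hFS y))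
  obtain ⟨g, ⟨u, hu, hgu⟩, hg⟩ := Metric.mem_closure_iff.1 hmem ε hε
  refine ⟨u, hu, fun t ht => ?_⟩
  let t' : J := ⟨t, abs_le.1 ht⟩
  have h1 : (∫ y, k y • F y) t' = ∫ y, k y * φ (t - y) := by
    have := (ContinuousMap.evalCLM ℝ t').integral_comp_comm hint
    simpa [F, t'] using! this.symm
  have h2 : u t = g t' := (hgu t').symm
  simp only
  rw [← h1, h2, ← Real.dist_eq]
  exact (ContinuousMap.dist_apply_le_dist t').trans hg.le

/-- Otherwise the `n`-th derivative of every mollification of `φ` vanishes. The first derivative is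
bounded by the Lipschitz constant, hence constant, so the mollifications are affine, and so is their
pointwise limit `φ`. -/
theorem exists_smooth_iteratedDeriv_ne_zero {φ : ℝ → ℝ}
    (hna : ¬ ∃ α β : ℝ, ∀ s, φ s = α * s + β) {K : NNReal} (hL : LipschitzWith K φ) (n : ℕ) :
    ∃ f ∈ locClosure (ridgeSpan φ), ContDiff ℝ (⊤ : ℕ∞) f ∧ ∃ b, iteratedDeriv n f b ≠ 0 := by
  by_contra! hcon
  apply hna
  let B : ℕ → ContDiffBump (0 : ℝ) := fun j =>
    ⟨1 / (2 * ((j : ℝ) + 1)), 1 / ((j : ℝ) + 1), by positivity, by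
      apply one_div_lt_one_div_of_lt <;> [positivity; nlinarith [Nat.cast_nonneg (α := ℝ) j]]⟩
  let f : ℕ → ℝ → ℝ := fun j =>
    MeasureTheory.convolution ((B j).normed MeasureTheory.volume) φ
      (ContinuousLinearMap.lsmul ℝ ℝ) MeasureTheory.volume
  have hfe : ∀ j, f j = fun x => ∫ y, (B j).normed MeasureTheory.volume y * φ (x - y) :=
    fun j => rfl
  have hlim : ∀ x, Tendsto (fun j => f j x) atTop (𝓝 (φ x)) := fun x =>
    ContDiffBump.convolution_tendsto_right_of_continuous
      tendsto_one_div_add_atTop_nhds_zero_nat hL.continuous x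
  have haff : ∀ j t, f j t = f j 0 + t * (f j 1 - f j 0) := by
    intro j
    have hc : ContDiff ℝ (⊤ : ℕ∞) (f j) :=
      (B j).hasCompactSupport_normed.contDiff_convolution_left _ (B j).contDiff_normed
        hL.continuous.locallyIntegrable
    have hV : f j ∈ locClosure (ridgeSpan φ) := by
      rw [hfe]
      exact integral_mul_comp_sub_mem_locClosure hL.continuous (B j).continuous_normed
        (B j).hasCompactSupport_normed
    have hint : ∀ x, MeasureTheory.Integrable
        fun y => (B j).normed MeasureTheory.volume y * φ (x - y) := fun x =>
      ((B j).continuous_normed.mul (hL.continuous.comp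
        (by fun_prop))).integrable_of_hasCompactSupport (B j).hasCompactSupport_normed.mul_right
    -- Averaging against a probability density preserves the Lipschitz constant, which bounds the
    -- derivative of `f j`.
    have hlip : LipschitzWith K (f j) := by
      refine LipschitzWith.of_dist_le_mul fun x y => ?_
      rw [hfe, dist_eq_norm, ← MeasureTheory.integral_sub (hint x) (hint y)]
      have : K * dist x y = ∫ z, (B j).normed MeasureTheory.volume z * (K * dist x y) := by
        rw [MeasureTheory.integral_mul_const, (B j).integral_normed, one_mul]
      rw [this]
      refine MeasureTheory.norm_integral_le_of_norm_le
        ((B j).integrable_normed.mul_const _) (Eventually.of_forall fun z => ?_)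
      rw [← mul_sub, norm_mul, Real.norm_of_nonneg ((B j).nonneg_normed z), ← dist_eq_norm]
      refine mul_le_mul_of_nonneg_left ?_ ((B j).nonneg_normed z)
      simpa using hL.dist_le_mul (x - z) (y - z)
    have hd : ContDiff ℝ (⊤ : ℕ∞) (deriv (f j)) :=
      ((contDiff_infty_iff_deriv (𝕜 := ℝ)).1 hc).2
    have hconst := eq_const_of_bounded_of_iteratedDeriv_eq_zero n (deriv (f j)) hd
      ⟨K, fun t => norm_deriv_le_of_lipschitz hlip⟩ (fun t => by
        have h0 : iteratedDeriv n (f j) = fun _ => 0 := funext (hcon _ hV hc)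
        rw [← iteratedDeriv_succ', iteratedDeriv_succ, h0, deriv_const])
    have hdiff : Differentiable ℝ (f j) := hc.differentiable (by simp)
    have hzero : ∀ t, deriv (fun t => f j t - t * deriv (f j) 0) t = 0 := by
      intro t
      have h1 : HasDerivAt (fun t => f j t - t * deriv (f j) 0)
          (deriv (f j) t - 1 * deriv (f j) 0) t :=
        (hdiff t).hasDerivAt.sub ((hasDerivAt_id t).mul_const _)
      rw [h1.deriv, hconst t 0]
      ring
    have hc' := is_const_of_deriv_eq_zero (hdiff.sub (by fun_prop)) hzero
    intro t
    have h1 := hc' t 0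
    have h2 := hc' 1 0
    simp only [Pi.sub_apply, one_mul, zero_mul, sub_zero] at h1 h2
    rw [← h2]
    linarith
  refine ⟨φ 1 - φ 0, φ 0, fun t => tendsto_nhds_unique (hlim t) ?_⟩
  have : Tendsto (fun j => f j 0 + t * (f j 1 - f j 0)) atTop (𝓝 (φ 0 + t * (φ 1 - φ 0))) :=
    (hlim 0).add (((hlim 1).sub (hlim 0)).const_mul t)
  rw [show (φ 1 - φ 0) * t + φ 0 = φ 0 + t * (φ 1 - φ 0) by ring]
  exact this.congr fun j => (haff j t).symm

/-- Every continuous function is a locally uniform limit of linear combinations of dilates and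
translates of a non-affine Lipschitz function. -/
theorem mem_locClosure_ridgeSpan {φ : ℝ → ℝ} (hna : ¬ ∃ α β : ℝ, ∀ s, φ s = α * s + β)
    {K : NNReal} (hL : LipschitzWith K φ) {u : ℝ → ℝ} (hu : Continuous u) :
    u ∈ locClosure (ridgeSpan φ) := by
  have hpow : ∀ k : ℕ, (fun t : ℝ => t ^ k) ∈ locClosure (ridgeSpan φ) := by
    intro k
    induction k using Nat.strong_induction_on with
    | _ k ih =>
      obtain ⟨f, hfV, hf, b, hb⟩ := exists_smooth_iteratedDeriv_ne_zero hna hL k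
      exact pow_mem_locClosure_step (hf.of_le (by exact_mod_cast le_top)) hfV hb ih
  apply mem_locClosure_of_approx
  intro R ε hε
  obtain ⟨p, hp⟩ := exists_polynomial_near_of_continuousOn (-R) R u hu.continuousOn ε hε
  refine ⟨fun t => p.eval t, ?_, fun t ht => ?_⟩
  · have : (fun t => p.eval t) =
        ∑ i ∈ Finset.range (p.natDegree + 1), p.coeff i • fun t : ℝ => t ^ i := by
      funext t
      simp [Polynomial.eval_eq_sum_range]
    rw [this]
    exact Submodule.sum_mem _ fun i _ => Submodule.smul_mem _ _ (hpow i)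
  · rw [abs_sub_comm]
    exact (hp t (abs_le.1 ht)).le

/-! ### Density of shallow networks in several variables -/

/-- The span of the ridge functions `x ↦ φ (w ⬝ x + β)` on `ℝᵃ`. -/
def ridgeSpanMulti (φ : ℝ → ℝ) (a : ℕ) : Submodule ℝ ((Fin a → ℝ) → ℝ) :=
  Submodule.span ℝ (range fun q : (Fin a → ℝ) × ℝ => fun x => φ (q.1 ⬝ᵥ x + q.2))

/-- The span of the vector-valued ridge functions `x ↦ φ (w ⬝ x + β) v`: the functions computed by
networks with a single hidden layer. -/
def shallowSpan (φ : ℝ → ℝ) (a b : ℕ) : Submodule ℝ ((Fin a → ℝ) → (Fin b → ℝ)) :=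
  Submodule.span ℝ (range fun q : (Fin a → ℝ) × ℝ × (Fin b → ℝ) =>
    fun x => φ (q.1 ⬝ᵥ x + q.2.1) • q.2.2)

theorem ridgeSpan_comp_dotProduct {φ u : ℝ → ℝ} (hu : u ∈ ridgeSpan φ) {a : ℕ} (w : Fin a → ℝ) :
    (fun x => u (w ⬝ᵥ x)) ∈ ridgeSpanMulti φ a := by
  induction hu using Submodule.span_induction with
  | mem u h =>
    obtain ⟨q, rfl⟩ := h
    refine Submodule.subset_span ⟨(q.1 • w, q.2), ?_⟩
    funext t
    simp
  | zero => exact Submodule.zero_mem _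
  | add u v _ _ h1 h2 => exact Submodule.add_mem _ h1 h2
  | smul c u _ h => exact Submodule.smul_mem _ c h

theorem continuous_of_mem_ridgeSpan {φ s : ℝ → ℝ} (hφ : Continuous φ) (hs : s ∈ ridgeSpan φ) :
    Continuous s := by
  induction hs using Submodule.span_induction with
  | mem u h =>
    obtain ⟨q, rfl⟩ := h
    exact hφ.comp (by fun_prop)
  | zero => exact continuous_zero
  | add u v _ _ h1 h2 => exact h1.add h2
  | smul c u _ h => exact h.const_smul c

theorem continuous_dotProduct_right {a : ℕ} (w : Fin a → ℝ) :
    Continuous fun x : Fin a → ℝ => w ⬝ᵥ x := by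
  unfold dotProduct
  fun_prop

/-- The restriction to `K` of the exponential function with frequency `w`. -/
noncomputable def expRidge {a : ℕ} (K : Set (Fin a → ℝ)) (w : Fin a → ℝ) : C(K, ℝ) :=
  ⟨fun x => Real.exp (w ⬝ᵥ x),
    Real.continuous_exp.comp ((continuous_dotProduct_right w).comp continuous_subtype_val)⟩

/-- Products of exponentials are exponentials, so their span is already an algebra; exponentials of
the coordinates separate points, and Stone–Weierstrass applies. -/
theorem span_expRidge_dense {a : ℕ} (K : Set (Fin a → ℝ)) [CompactSpace K] :
    (Submodule.span ℝ (range (expRidge K))).topologicalClosure = ⊤ := by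
  let M : Submonoid C(K, ℝ) :=
    { carrier := range (expRidge K)
      one_mem' := ⟨0, by ext x; simp [expRidge]⟩
      mul_mem' := by
        rintro _ _ ⟨w, rfl⟩ ⟨w', rfl⟩
        exact ⟨w + w', by ext x; simp [expRidge, add_dotProduct, Real.exp_add]⟩ }
  have h1 : Subalgebra.toSubmodule (Algebra.adjoin ℝ (range (expRidge K))) =
      Submodule.span ℝ (range (expRidge K)) := by
    rw [Algebra.adjoin_eq_span]
    congr 1
    have := Submonoid.closure_eq M
    exact congrArg SetLike.coe this
  have hsep : (Algebra.adjoin ℝ (range (expRidge K))).SeparatesPoints := by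
    intro x y hxy
    obtain ⟨i, hi⟩ := Function.ne_iff.1 (fun h => hxy (Subtype.ext h))
    refine ⟨_, ⟨expRidge K (Pi.single i 1), Algebra.subset_adjoin ⟨_, rfl⟩, rfl⟩, ?_⟩
    simpa [expRidge] using hi
  have h2 := ContinuousMap.subalgebra_topologicalClosure_eq_top_of_separatesPoints _ hsep
  rw [← h1]
  have h3 := congrArg Subalgebra.toSubmodule h2
  exact h3

/-- On a compact set `w ⬝ᵥ x` is bounded, so the one-variable result applied to `exp` puts each `exp
(w ⬝ᵥ x)` into the closure of the ridge span; these exponentials have dense span. -/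
theorem exists_ridgeSpanMulti_approx {φ : ℝ → ℝ} (hna : ¬ ∃ α β : ℝ, ∀ s, φ s = α * s + β)
    {C : NNReal} (hL : LipschitzWith C φ) {a : ℕ} {K : Set (Fin a → ℝ)} (hK : IsCompact K)
    {f : (Fin a → ℝ) → ℝ} (hf : ContinuousOn f K) {ε : ℝ} (hε : 0 < ε) :
    ∃ s ∈ ridgeSpanMulti φ a, ∀ x ∈ K, |f x - s x| ≤ ε := by
  have : CompactSpace K := isCompact_iff_compactSpace.1 hK
  let S := restrictSubmodule K (ridgeSpanMulti φ a)
  have hφ := hL.continuous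
  have hexp : ∀ w, expRidge K w ∈ S.topologicalClosure := by
    intro w
    refine Metric.mem_closure_iff.2 fun δ hδ => ?_
    obtain ⟨R, hR⟩ := hK.exists_bound_of_continuousOn (continuous_dotProduct_right w).continuousOn
    obtain ⟨s, hs, h⟩ := mem_locClosure_ridgeSpan hna hL Real.continuous_exp R (δ / 2)
      (by positivity)
    have hsc : Continuous s := continuous_of_mem_ridgeSpan hφ hs
    refine ⟨⟨fun x => s (w ⬝ᵥ x), hsc.comp
      ((continuous_dotProduct_right w).comp continuous_subtype_val)⟩,
      ⟨_, ridgeSpan_comp_dotProduct hs w, fun t => rfl⟩, ?_⟩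
    refine lt_of_le_of_lt ((ContinuousMap.dist_le (by positivity)).2 fun x => ?_) (half_lt_self hδ)
    rw [Real.dist_eq]
    exact h _ (hR x x.2)
  have htop : S.topologicalClosure = ⊤ := by
    rw [eq_top_iff, ← span_expRidge_dense K]
    refine Submodule.topologicalClosure_minimal _ ?_ S.isClosed_topologicalClosure
    rw [Submodule.span_le]
    rintro _ ⟨w, rfl⟩
    exact hexp w
  let f' : C(K, ℝ) := ⟨K.domRestrict f, hf.domRestrict⟩
  have hf' : f' ∈ S.topologicalClosure := htop ▸ Submodule.mem_top
  obtain ⟨g, ⟨u, hu, hgu⟩, hg⟩ := Metric.mem_closure_iff.1 hf' ε hε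
  refine ⟨u, hu, fun x hx => ?_⟩
  have h2 : u x = g ⟨x, hx⟩ := (hgu ⟨x, hx⟩).symm
  rw [h2, ← Real.dist_eq]
  exact (ContinuousMap.dist_apply_le_dist (f := f') (g := g) ⟨x, hx⟩).trans hg.le

theorem exists_shallowSpan_approx {φ : ℝ → ℝ} (hna : ¬ ∃ α β : ℝ, ∀ s, φ s = α * s + β)
    {C : NNReal} (hL : LipschitzWith C φ) {a b : ℕ} {K : Set (Fin a → ℝ)} (hK : IsCompact K)
    {f : (Fin a → ℝ) → (Fin b → ℝ)} (hf : ContinuousOn f K) {ε : ℝ} (hε : 0 < ε) :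
    ∃ G ∈ shallowSpan φ a b, ∀ x ∈ K, ∀ i, |f x i - G x i| ≤ ε := by
  have h : ∀ i, ∃ s ∈ ridgeSpanMulti φ a, ∀ x ∈ K, |f x i - s x| ≤ ε := fun i =>
    exists_ridgeSpanMulti_approx hna hL hK (continuousOn_pi.1 hf i) hε
  choose s hs h using h
  let J : Fin b → ((Fin a → ℝ) → ℝ) →ₗ[ℝ] ((Fin a → ℝ) → (Fin b → ℝ)) := fun i =>
    { toFun := fun u x => u x • Pi.single i 1
      map_add' := fun u v => by funext x; simp [add_smul]
      map_smul' := fun c u => by funext x; simp [mul_smul] }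
  have hJ : ∀ i, ∀ u ∈ ridgeSpanMulti φ a, J i u ∈ shallowSpan φ a b := by
    intro i
    change ridgeSpanMulti φ a ≤ (shallowSpan φ a b).comap (J i)
    rw [ridgeSpanMulti, Submodule.span_le]
    rintro _ ⟨q, rfl⟩
    exact Submodule.subset_span ⟨(q.1, q.2, Pi.single i 1), rfl⟩
  refine ⟨∑ i, J i (s i), Submodule.sum_mem _ fun i _ => hJ i _ (hs i), fun x hx i => ?_⟩
  have : (∑ j, J j (s j)) x i = s i x := by
    simp [J, Finset.sum_apply, Pi.single_apply]
  rw [this]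
  exact h i x hx

/-! ### Deep narrow networks -/

/-- Rescaled difference quotients of `φ` approximate the identity. -/
theorem exists_approx_id {φ : ℝ → ℝ} {z c : ℝ} (h : HasDerivAt φ c z) (hc : c ≠ 0) (R : ℝ) {η : ℝ}
    (hη : 0 < η) : ∃ s : ℝ, ∀ y, |y| ≤ R → |(φ (s * y + z) - φ z) / (s * c) - y| ≤ η := by
  set R' : ℝ := |R| + 1
  have hR' : 0 < R' := by positivity
  have hc' : 0 < |c| := abs_pos.2 hc
  have ho := (hasDerivAt_iff_isLittleO.1 h).def (c := |c| * η / R') (by positivity)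
  obtain ⟨δ, hδ, hball⟩ := Metric.eventually_nhds_iff.1 ho
  set s : ℝ := δ / (2 * R')
  have hs : 0 < s := by positivity
  refine ⟨s, fun y hy => ?_⟩
  have hyR : |y| ≤ R' := hy.trans (by linarith [le_abs_self R])
  have hd : dist (s * y + z) z < δ := by
    rw [Real.dist_eq, add_sub_cancel_right, abs_mul, abs_of_pos hs]
    calc s * |y| ≤ s * R' := by gcongr
      _ = δ / 2 := by simp only [s]; field_simp
      _ < δ := by linarith
  have h1 := hball hd
  simp only [add_sub_cancel_right, smul_eq_mul, Real.norm_eq_abs] at h1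
  have e : (φ (s * y + z) - φ z) / (s * c) - y =
      (φ (s * y + z) - φ z - s * y * c) / (s * c) := by field_simp
  rw [e, abs_div, div_le_iff₀ (by positivity)]
  refine h1.trans ?_
  rw [abs_mul, abs_mul, abs_of_pos hs]
  calc |c| * η / R' * (s * |y|) ≤ |c| * η / R' * (s * R') := by gcongr
    _ = η * (s * |c|) := by field_simp

/-- A single layer carrying two registers `A u + q` and `B u + r` along through identity-like
neurons and adding a ridge function to the second one. -/
theorem exists_register_layer (φ : ℝ → ℝ) (z c s : ℝ) {a b n : ℕ}
    (A : Matrix (Fin a) (Fin n) ℝ) (q : Fin a → ℝ) (B : Matrix (Fin b) (Fin n) ℝ) (r : Fin b → ℝ)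
    (w : Fin a → ℝ) (β₀ : ℝ) (v : Fin b → ℝ) :
    ∃ (W : Matrix (Fin (a + b + 2)) (Fin n) ℝ) (β : Fin (a + b + 2) → ℝ)
      (A' : Matrix (Fin a) (Fin (a + b + 2)) ℝ) (q' : Fin a → ℝ)
      (B' : Matrix (Fin b) (Fin (a + b + 2)) ℝ) (r' : Fin b → ℝ), ∀ u : Fin n → ℝ,
      (∀ i, (A' *ᵥ (fun j => φ ((W *ᵥ u + β) j)) + q') i =
        (φ (s * (A *ᵥ u + q) i + z) - φ z) / c) ∧
      ∀ k, (B' *ᵥ (fun j => φ ((W *ᵥ u + β) j)) + r') k =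
        (φ (s * (B *ᵥ u + r) k + z) - φ z) / c + φ (w ⬝ᵥ (A *ᵥ u + q) + β₀) * v k := by
  -- The first `a` neurons carry the first register and the next `b` the second. Both remaining
  -- neurons compute the ridge function, but only the first of them is read out. Since readouts are
  -- affine, the next layer can absorb them into its weights.
  refine ⟨Matrix.of (Fin.append (Fin.append (fun i => s • A i) fun k => s • B k) fun _ => w ᵥ* A),
    Fin.append (Fin.append (fun i => s * q i + z) fun k => s * r k + z) fun _ => w ⬝ᵥ q + β₀,
    Matrix.of fun i => Pi.single (Fin.castAdd 2 (Fin.castAdd b i)) c⁻¹, fun _ => -(φ z / c),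
    Matrix.of fun k => Pi.single (Fin.castAdd 2 (Fin.natAdd a k)) c⁻¹ +
      Pi.single (Fin.natAdd (a + b) 0) (v k), fun _ => -(φ z / c), fun u => ⟨fun i => ?_, fun k => ?_⟩⟩
  · have e : s • A i ⬝ᵥ u + (s * q i + z) = s * (A i ⬝ᵥ u + q i) + z := by
      rw [smul_dotProduct, smul_eq_mul]; ring
    simp only [Pi.add_apply, Matrix.mulVec, Matrix.of_apply, single_dotProduct, Fin.append_left, e]
    ring
  · have e : s • B k ⬝ᵥ u + (s * r k + z) = s * (B k ⬝ᵥ u + r k) + z := by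
      rw [smul_dotProduct, smul_eq_mul]; ring
    have e' : w ᵥ* A ⬝ᵥ u + (w ⬝ᵥ q + β₀) = w ⬝ᵥ (A *ᵥ u + q) + β₀ := by
      rw [dotProduct_add, Matrix.dotProduct_mulVec]; ring
    change (Pi.single (Fin.castAdd 2 (Fin.natAdd a k)) c⁻¹ + Pi.single (Fin.natAdd (a + b) 0) (v k))
      ⬝ᵥ (fun j => φ (Fin.append (Fin.append (fun i => s • A i) fun k => s • B k)
        (fun _ => w ᵥ* A) j ⬝ᵥ u + Fin.append (Fin.append (fun i => s * q i + z)
        fun k => s * r k + z) (fun _ => w ⬝ᵥ q + β₀) j)) + -(φ z / c) =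
      (φ (s * (B k ⬝ᵥ u + r k) + z) - φ z) / c + φ (w ⬝ᵥ (A *ᵥ u + q) + β₀) * v k
    simp only [add_dotProduct, single_dotProduct, Fin.append_left, Fin.append_right, e, e']
    ring

/-- The function `acc` can be approximated on compact sets by affine readouts of deep narrow
networks which at the same time allow to read out their input. -/
def Realizable (φ : ℝ → ℝ) (a b : ℕ) (acc : (Fin a → ℝ) → (Fin b → ℝ)) : Prop :=
  ∀ K : Set (Fin a → ℝ), IsCompact K → ∀ ε : ℝ, 0 < ε →
    ∃ F : (Fin a → ℝ) → (Fin (a + b + 2) → ℝ), HiddenLayers φ a (a + b + 2) F ∧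
      ∃ (A : Matrix (Fin a) (Fin (a + b + 2)) ℝ) (q : Fin a → ℝ)
        (B : Matrix (Fin b) (Fin (a + b + 2)) ℝ) (r : Fin b → ℝ), ∀ x ∈ K,
        (∀ i, |(A *ᵥ F x + q) i - x i| ≤ ε) ∧ ∀ k, |(B *ᵥ F x + r) k - acc x k| ≤ ε

theorem exists_abs_le_of_isCompact {a b : ℕ} {K : Set (Fin a → ℝ)} (hK : IsCompact K)
    {g : (Fin a → ℝ) → (Fin b → ℝ)} (hg : Continuous g) : ∃ R, ∀ x ∈ K, ∀ i, |g x i| ≤ R := by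
  obtain ⟨R, hR⟩ := hK.exists_bound_of_continuousOn hg.continuousOn
  exact ⟨R, fun x hx i => (norm_le_pi_norm (g x) i).trans (hR x hx)⟩

/-- One layer copies the input through nearly linear neurons; the accumulator neurons receive zero
weights, so that their readout vanishes exactly. -/
theorem realizable_zero {φ : ℝ → ℝ} {z c : ℝ} (h : HasDerivAt φ c z) (hc : c ≠ 0) (a b : ℕ) :
    Realizable φ a b 0 := by
  intro K hK ε hε
  obtain ⟨R, hR⟩ := exists_abs_le_of_isCompact hK continuous_id
  obtain ⟨s, hs⟩ := exists_approx_id h hc (max R 0) hε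
  obtain ⟨W, β, A, q, B, r, hW⟩ := exists_register_layer φ z (s * c) s (1 : Matrix (Fin a) (Fin a) ℝ)
    0 (0 : Matrix (Fin b) (Fin a) ℝ) 0 0 0 0
  refine ⟨_, HiddenLayers.first W β, A, q, B, r, fun x hx => ⟨fun i => ?_, fun k => ?_⟩⟩
  · rw [(hW x).1 i]
    simpa using hs (x i) ((hR x hx i).trans (le_max_left _ _))
  · rw [(hW x).2 k]
    simpa using hε.le

theorem abs_dotProduct_sub_le {a : ℕ} (w x y : Fin a → ℝ) {ε : ℝ} (h : ∀ i, |x i - y i| ≤ ε) :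
    |w ⬝ᵥ x - w ⬝ᵥ y| ≤ (∑ i, |w i|) * ε := by
  rw [← dotProduct_sub, dotProduct, Finset.sum_mul]
  refine (Finset.abs_sum_le_sum_abs _ _).trans (Finset.sum_le_sum fun i _ => ?_)
  rw [abs_mul]
  exact mul_le_mul_of_nonneg_left (h i) (abs_nonneg _)

theorem Realizable.add_ridge {φ : ℝ → ℝ} {z c : ℝ} (h : HasDerivAt φ c z) (hc : c ≠ 0)
    {C : NNReal} (hL : LipschitzWith C φ) {a b : ℕ} {acc : (Fin a → ℝ) → (Fin b → ℝ)}
    (hacc : Realizable φ a b acc) (hcont : Continuous acc) (w : Fin a → ℝ) (β₀ : ℝ)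
    (v : Fin b → ℝ) :
    Realizable φ a b (acc + fun x => φ (w ⬝ᵥ x + β₀) • v) := by
  intro K hK ε hε
  obtain ⟨R₁, hR₁⟩ := exists_abs_le_of_isCompact hK continuous_id
  obtain ⟨R₂, hR₂⟩ := exists_abs_le_of_isCompact hK hcont
  set S : ℝ := C * (∑ i, |w i|) * ‖v‖
  have hS : 0 ≤ S := by positivity
  -- `δ` is the error allowed in the earlier layers. Its direct effect `δ` and its effect `S * δ`
  -- through the new ridge term cost together at most `ε / 2`, the identity-like neurons cost the
  -- other half, and `δ ≤ 1` keeps the registers in the range where these neurons are accurate.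
  set δ : ℝ := min 1 (ε / (2 * (1 + S)))
  have hδ : 0 < δ := by positivity
  have hδ1 : δ ≤ 1 := min_le_left _ _
  have hδε : δ + S * δ ≤ ε / 2 := by
    have : δ * (2 * (1 + S)) ≤ ε := (le_div_iff₀ (by positivity)).1 (min_le_right _ _)
    linarith
  obtain ⟨F, hF, A, q, B, r, hFx⟩ := hacc K hK δ hδ
  obtain ⟨s, hs⟩ := exists_approx_id h hc (max R₁ R₂ + 1) (half_pos hε)
  obtain ⟨W, β, A', q', B', r', hW⟩ := exists_register_layer φ z (s * c) s A q B r w β₀ v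
  have hpass : ∀ y t : ℝ, |y - t| ≤ δ → |t| ≤ max R₁ R₂ →
      |(φ (s * y + z) - φ z) / (s * c) - t| ≤ ε / 2 + δ := by
    intro y t hyt ht
    have hy : |y| ≤ max R₁ R₂ + 1 := by
      have := abs_sub_abs_le_abs_sub y t
      linarith
    exact (abs_sub_le _ y t).trans (add_le_add (hs y hy) hyt)
  refine ⟨_, HiddenLayers.next F hF W β, A', q', B', r', fun x hx => ⟨fun i => ?_, fun k => ?_⟩⟩
  · rw [(hW (F x)).1 i]
    have := hpass _ _ ((hFx x hx).1 i) ((hR₁ x hx i).trans (le_max_left _ _))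
    nlinarith
  · rw [(hW (F x)).2 k]
    have h1 := hpass _ _ ((hFx x hx).2 k) ((hR₂ x hx k).trans (le_max_right _ _))
    have h2 := hL.dist_le_mul (w ⬝ᵥ (A *ᵥ F x + q) + β₀) (w ⬝ᵥ x + β₀)
    rw [Real.dist_eq, Real.dist_eq, add_sub_add_right_eq_sub] at h2
    have h3 := abs_dotProduct_sub_le w _ _ (hFx x hx).1
    have h4 : |φ (w ⬝ᵥ (A *ᵥ F x + q) + β₀) * v k - φ (w ⬝ᵥ x + β₀) * v k| ≤ S * δ := by
      rw [← sub_mul, abs_mul]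
      calc _ ≤ (C * ((∑ i, |w i|) * δ)) * ‖v‖ := by
            gcongr
            · exact h2.trans (by gcongr)
            · exact norm_le_pi_norm v k
        _ = S * δ := by simp only [S]; ring
    change |_ - (acc x k + φ (w ⬝ᵥ x + β₀) * v k)| ≤ ε
    rw [add_sub_add_comm]
    refine (abs_add_le _ _).trans ?_
    linarith

theorem continuous_of_mem_shallowSpan {φ : ℝ → ℝ} (hφ : Continuous φ) {a b : ℕ}
    {G : (Fin a → ℝ) → (Fin b → ℝ)} (hG : G ∈ shallowSpan φ a b) : Continuous G := by
  induction hG using Submodule.span_induction with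
  | mem u h =>
    obtain ⟨q, rfl⟩ := h
    exact (hφ.comp ((continuous_dotProduct_right q.1).add continuous_const)).smul continuous_const
  | zero => exact continuous_zero
  | add u v _ _ h1 h2 => exact h1.add h2
  | smul c u _ h => exact h.const_smul c

/-- A realization of a sum must add its terms to one accumulator in succession. The induction over
the span therefore keeps an arbitrary `acc` and absorbs scalars into `κ`. -/
theorem Realizable.add_shallow {φ : ℝ → ℝ} {z c : ℝ} (h : HasDerivAt φ c z) (hc : c ≠ 0)
    {C : NNReal} (hL : LipschitzWith C φ) {a b : ℕ} {G : (Fin a → ℝ) → (Fin b → ℝ)}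
    (hG : G ∈ shallowSpan φ a b) :
    ∀ (κ : ℝ) (acc : (Fin a → ℝ) → (Fin b → ℝ)), Realizable φ a b acc → Continuous acc →
      Realizable φ a b (acc + κ • G) := by
  induction hG using Submodule.span_induction with
  | mem u hu =>
    obtain ⟨q, rfl⟩ := hu
    intro κ acc hacc hcont
    have := hacc.add_ridge h hc hL hcont q.1 q.2.1 (κ • q.2.2)
    convert this using 2
    funext x
    simp [smul_smul, mul_comm]
  | zero => intro κ acc hacc _; simpa using hacc
  | add u v hu hv h1 h2 =>
    intro κ acc hacc hcont
    have := h2 κ _ (h1 κ acc hacc hcont)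
      (hcont.add ((continuous_of_mem_shallowSpan hL.continuous hu).const_smul κ))
    rwa [add_assoc, ← smul_add] at this
  | smul κ' u _ hu =>
    intro κ acc hacc hcont
    rw [smul_smul]
    exact hu _ acc hacc hcont

/-- **Universal approximation** by deep narrow networks. -/
theorem exists_netClass_approx {φ : ℝ → ℝ} (hφ : IsActivation φ) {a b : ℕ} {K : Set (Vec a)}
    (hK : IsCompact K) {f : Vec a → Vec b} (hf : ContinuousOn f K) {ε : ℝ} (hε : 0 < ε) :
    ∃ N ∈ NetClass φ a b, ∀ x ∈ K, ‖f x - N x‖ ≤ ε := by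
  obtain ⟨hna, ⟨C, hL⟩, z, hz, -, hc⟩ := hφ
  have hd := hz.self_of_nhds.hasDerivAt
  -- Two errors of size `η` per coordinate give `ε / (b + 1)`, and `b * (ε / (b + 1)) ^ 2 ≤ ε ^ 2`;
  -- the `+ 1` covers `b = 0`.
  set η : ℝ := ε / (2 * (b + 1))
  have hη : 0 < η := by positivity
  set K' : Set (Fin a → ℝ) := WithLp.ofLp '' K
  have hK' : IsCompact K' := hK.image (PiLp.continuous_ofLp 2 _)
  have hf' : ContinuousOn (fun x => (f (WithLp.toLp 2 x)).ofLp) K' := by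
    refine (PiLp.continuous_ofLp 2 _).comp_continuousOn
      (hf.comp (PiLp.continuous_toLp 2 _).continuousOn ?_)
    rintro _ ⟨x, hx, rfl⟩
    exact hx
  obtain ⟨G, hG, hGf⟩ := exists_shallowSpan_approx hna hL hK' hf' hη
  have hR : Realizable φ a b G := by
    simpa using Realizable.add_shallow hd hc hL hG 1 0 (realizable_zero hd hc a b) continuous_zero
  obtain ⟨F, hF, _, _, B, r, hFx⟩ := hR K' hK' η hη
  refine ⟨_, ⟨F, hF, B, r, rfl⟩, fun x hx => ?_⟩
  have hi : ∀ i, |(f x - WithLp.toLp 2 (B *ᵥ F x.ofLp + r)) i| ≤ ε / (b + 1) := by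
    intro i
    have h1 := hGf x.ofLp ⟨x, hx, rfl⟩ i
    have h2 := (hFx x.ofLp ⟨x, hx, rfl⟩).2 i
    rw [abs_sub_comm] at h2
    have h3 : η + η = ε / (b + 1) := by simp only [η]; field_simp; norm_num
    rw [← h3]
    exact (abs_sub_le _ (G x.ofLp i) _).trans (add_le_add h1 h2)
  rw [EuclideanSpace.norm_eq]
  refine Real.sqrt_le_iff.2 ⟨hε.le, ?_⟩
  calc _ ≤ ∑ _i : Fin b, (ε / (b + 1)) ^ 2 := by
        refine Finset.sum_le_sum fun i _ => ?_
        rw [Real.norm_eq_abs]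
        exact pow_le_pow_left₀ (abs_nonneg _) (hi i) 2
    _ = b * (ε / (b + 1)) ^ 2 := by simp
    _ ≤ ε ^ 2 := by
        rw [div_pow, mul_div_assoc', div_le_iff₀ (by positivity)]
        have hb : (0 : ℝ) ≤ b := Nat.cast_nonneg b
        nlinarith [sq_nonneg ε, mul_nonneg hb (sq_nonneg ε)]

/-- The functions in `NetClass` are Lipschitz if the activation function is. -/
theorem exists_lipschitzWith_of_mem_netClass {φ : ℝ → ℝ} {C : NNReal} (hL : LipschitzWith C φ)
    {a b : ℕ} {N : Vec a → Vec b} (hN : N ∈ NetClass φ a b) : ∃ L, LipschitzWith L N := by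
  have hmat : ∀ {p n : ℕ} (W : Matrix (Fin n) (Fin p) ℝ) (β : Fin n → ℝ),
      ∃ L, LipschitzWith L fun x => W *ᵥ x + β := by
    intro p n W β
    refine ⟨_, LipschitzWith.of_dist_le_mul (K := ‖(Matrix.mulVecLin W).toContinuousLinearMap‖₊)
      fun x y => ?_⟩
    rw [dist_add_right]
    exact (Matrix.mulVecLin W).toContinuousLinearMap.lipschitz.dist_le_mul x y
  have hφ : ∀ n : ℕ, LipschitzWith C fun (y : Fin n → ℝ) i => φ (y i) := fun n =>
    LipschitzWith.of_dist_le_mul fun x y => (dist_pi_le_iff (by positivity)).2 fun i =>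
      (hL.dist_le_mul _ _).trans (by gcongr; exact dist_le_pi_dist x y i)
  have hid : ∀ F : (Fin a → ℝ) → (Fin (a + b + 2) → ℝ), HiddenLayers φ a (a + b + 2) F →
      ∃ L, LipschitzWith L F := by
    intro F hF
    induction hF with
    | first W β =>
      obtain ⟨L, h⟩ := hmat W β
      exact ⟨_, (hφ _).comp h⟩
    | next F _ W β ih =>
      obtain ⟨L, h⟩ := hmat W β
      obtain ⟨L', h'⟩ := ih
      exact ⟨_, (hφ _).comp (h.comp h')⟩
  obtain ⟨F, hF, A, γ, rfl⟩ := hN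
  obtain ⟨L, h⟩ := hid F hF
  obtain ⟨L', h'⟩ := hmat A γ
  exact ⟨_, (PiLp.lipschitzWith_toLp 2 _).comp ((h'.comp h).comp (PiLp.lipschitzWith_ofLp 2 _))⟩

theorem add_const_mem_netClass {φ : ℝ → ℝ} {a b : ℕ} {N : Vec a → Vec b} (hN : N ∈ NetClass φ a b)
    (κ : Vec b) : (fun x => N x + κ) ∈ NetClass φ a b := by
  obtain ⟨F, hF, A, γ, rfl⟩ := hN
  refine ⟨F, hF, A, γ + κ.ofLp, ?_⟩
  funext x
  ext i
  simp [add_assoc]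

/-! ### Global solutions and continuity of the flow map -/

theorem norm_join_sub_left {a b : ℕ} (x y : Vec a) (p : Vec b) :
    ‖join x p - join y p‖ = ‖x - y‖ := by
  simp [EuclideanSpace.norm_eq, join, Fin.sum_univ_add]

theorem norm_join_sub_right {a b : ℕ} (x : Vec a) (p q : Vec b) :
    ‖join x p - join x q‖ = ‖p - q‖ := by
  simp [EuclideanSpace.norm_eq, join, Fin.sum_univ_add]

/-- The componentwise projection onto the cube `[-R, R]ⁿ`. -/
def clamp {n : ℕ} (R : ℝ) (x : Vec n) : Vec n :=
  WithLp.toLp 2 fun i => max (-R) (min R (x i))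

theorem norm_clamp_sub_le {n : ℕ} (R : ℝ) (x y : Vec n) : ‖clamp R x - clamp R y‖ ≤ ‖x - y‖ := by
  rw [EuclideanSpace.norm_eq, EuclideanSpace.norm_eq]
  refine Real.sqrt_le_sqrt (Finset.sum_le_sum fun i _ => ?_)
  refine pow_le_pow_left₀ (norm_nonneg _) ?_ 2
  simp only [clamp, PiLp.sub_apply, Real.norm_eq_abs]
  refine (abs_max_sub_max_le_max _ _ _ _).trans ?_
  rw [sub_self, abs_zero]
  refine max_le (abs_nonneg _) ((abs_min_sub_min_le_max _ _ _ _).trans ?_)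
  simp

theorem clamp_eq_self {n : ℕ} {R : ℝ} {x : Vec n} (hx : ‖x‖ ≤ R) : clamp R x = x := by
  ext i
  have h := abs_le.1 ((PiLp.norm_apply_le x i).trans hx)
  simp [clamp, h.1, h.2]

theorem norm_clamp_le {n : ℕ} {R : ℝ} (hR : 0 ≤ R) (x : Vec n) : ‖clamp R x‖ ≤ ‖x‖ := by
  have h0 : clamp R (0 : Vec n) = 0 := clamp_eq_self (by simpa using hR)
  simpa [h0] using norm_clamp_sub_le R x 0

theorem exists_bound_comp_clamp {n : ℕ} (R : ℝ) {F : Vec n → Vec n} (hF : Continuous F) :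
    ∃ B : NNReal, ∀ x, ‖F (clamp R x)‖ ≤ B := by
  -- The minimum and maximum make the box contain all values of `clamp R` for either sign of `R`.
  have hc : IsCompact (WithLp.toLp 2 '' (Icc (fun _ => min (-R) R) fun _ => max (-R) R) :
      Set (Vec n)) := isCompact_Icc.image (PiLp.continuous_toLp 2 _)
  obtain ⟨B, hB⟩ := hc.exists_bound_of_continuousOn hF.continuousOn
  refine ⟨B.toNNReal, fun x => (hB _ ⟨fun i => max (-R) (min R (x i)), ⟨fun i => ?_, fun i => ?_⟩,
    rfl⟩).trans (Real.le_coe_toNNReal B)⟩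
  · exact (min_le_left _ _).trans (le_max_left _ _)
  · exact max_le_max le_rfl (min_le_left _ _)

/-- The truncated field `G` is bounded, so Picard–Lindelöf reaches the whole interval in one step.
It grows at most linearly, with constants taken from `F`, so Gronwall confines its solution to the
ball of radius `R`, where `G` equals `F`. Negative times are treated by reflection. -/
theorem exists_solution_Ioo {n : ℕ} {F : Vec n → Vec n} {M : NNReal} (hF : LipschitzWith M F)
    (x₀ : Vec n) {T : ℝ} (hT : 0 ≤ T) :
    ∃ x : ℝ → Vec n, x 0 = x₀ ∧ ∀ t ∈ Ioo (-T) T, HasDerivAt x (F (x t)) t := by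
  set R := gronwallBound ‖x₀‖ M ‖F 0‖ T
  have hmono := gronwallBound_mono (norm_nonneg x₀) (norm_nonneg (F 0)) M.coe_nonneg
  have hR : 0 ≤ R := by
    have h1 := hmono hT
    rw [gronwallBound_x0] at h1
    exact (norm_nonneg _).trans h1
  set G : Vec n → Vec n := fun x => F (clamp R x)
  have hG : LipschitzWith M G := by
    refine LipschitzWith.of_dist_le_mul fun x y => (hF.dist_le_mul _ _).trans ?_
    rw [dist_eq_norm, dist_eq_norm]
    gcongr
    exact norm_clamp_sub_le R x y
  have hgrow : ∀ x, ‖G x‖ ≤ M * ‖x‖ + ‖F 0‖ := by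
    intro x
    have h1 := hF.dist_le_mul (clamp R x) 0
    rw [dist_eq_norm, dist_zero_right] at h1
    have h2 : M * ‖clamp R x‖ ≤ M * ‖x‖ := by gcongr; exact norm_clamp_le hR x
    have h3 := norm_le_norm_sub_add (F (clamp R x)) (F 0)
    linarith
  obtain ⟨B, hB⟩ := exists_bound_comp_clamp R hF.continuous
  have hpl : IsPicardLindelof (fun _ => G) (tmin := -T) (tmax := T)
      ⟨0, by simpa using hT⟩ x₀ (B * T.toNNReal) 0 B M :=
    IsPicardLindelof.of_time_independent (fun x _ => hB x) hG.lipschitzOnWith (by simp [hT])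
  obtain ⟨x, hx0, hx⟩ := hpl.exists_eq_forall_mem_Icc_hasDerivWithinAt₀
  have hx0' : x 0 = x₀ := hx0
  have hcont : ContinuousOn x (Icc (-T) T) := fun t ht => (hx t ht).continuousWithinAt
  have hderiv : ∀ t ∈ Ioo (-T) T, HasDerivAt x (G (x t)) t := fun t ht =>
    (hx t (Ioo_subset_Icc_self ht)).hasDerivAt (Icc_mem_nhds ht.1 ht.2)
  have hpos : ∀ t ∈ Icc 0 T, ‖x t‖ ≤ R := by
    intro t ht
    have h1 := norm_le_gronwallBound_of_norm_deriv_right_le (f := x) (f' := fun t => G (x t))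
      (K := M) (ε := ‖F 0‖) (a := 0) (b := T) (hcont.mono (Icc_subset_Icc_left (by linarith)))
      (fun t ht => ((hx t ⟨by linarith [ht.1], ht.2.le⟩).mono_of_mem_nhdsWithin
        (mem_of_superset (Icc_mem_nhdsGE ht.2) (Icc_subset_Icc_left (by linarith [ht.1])))))
      (by rw [hx0']) (fun t _ => hgrow _) t ht
    exact h1.trans (hmono (by linarith [ht.2]))
  have hneg : ∀ t ∈ Icc 0 T, ‖x (-t)‖ ≤ R := by
    intro t ht
    have h1 := norm_le_gronwallBound_of_norm_deriv_right_le (f := fun t => x (-t))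
      (f' := fun t => -G (x (-t)))
      (K := M) (ε := ‖F 0‖) (a := 0) (b := T)
      (hcont.comp continuous_neg.continuousOn fun t ht => ⟨by linarith [ht.2], by linarith [ht.1]⟩)
      (fun t ht => by
        have h2 := hx (-t) ⟨by linarith [ht.2], by linarith [ht.1]⟩
        have h3 : HasDerivWithinAt (fun t => x (-t)) ((-1 : ℝ) • G (x (-t))) (Icc (-T) T) t :=
          h2.scomp t (hasDerivAt_neg t).hasDerivWithinAt
            fun s hs => ⟨by linarith [hs.2], by linarith [hs.1]⟩
        rw [neg_one_smul] at h3
        exact h3.mono_of_mem_nhdsWithin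
          (mem_of_superset (Icc_mem_nhdsGE ht.2) (Icc_subset_Icc_left (by linarith [ht.1]))))
      (by rw [neg_zero, hx0']) (fun t _ => by rw [norm_neg]; exact hgrow _) t ht
    exact h1.trans (hmono (by linarith [ht.2]))
  refine ⟨x, hx0', fun t ht => ?_⟩
  have hle : ‖x t‖ ≤ R := by
    rcases le_total 0 t with h | h
    · exact hpos t ⟨h, ht.2.le⟩
    · simpa using hneg (-t) ⟨by linarith, by linarith [ht.1]⟩
  have h1 := hderiv t ht
  simp only [G, clamp_eq_self hle] at h1
  exact h1

/-- Globally Lipschitz vector fields have global integral curves. -/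
theorem exists_global_solution {n : ℕ} {F : Vec n → Vec n} {M : NNReal} (hF : LipschitzWith M F)
    (x₀ : Vec n) : ∃ x : ℝ → Vec n, x 0 = x₀ ∧ ∀ t, HasDerivAt x (F (x t)) t := by
  have h : ∀ k : ℕ, ∃ x : ℝ → Vec n, x 0 = x₀ ∧
      ∀ t ∈ Ioo (-((k : ℝ) + 1)) ((k : ℝ) + 1), HasDerivAt x (F (x t)) t := fun k =>
    exists_solution_Ioo hF x₀ (by positivity)
  choose x hx0 hx using h
  have huniq : ∀ k m : ℕ, k ≤ m → ∀ t : ℝ, |t| ≤ k → x k t = x m t := by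
    intro k m hkm t ht
    have hkm' : (k : ℝ) ≤ m := Nat.cast_le.2 hkm
    refine ODE_solution_unique_of_mem_Ioo (v := fun _ => F) (s := fun _ => univ) (K := M)
      (a := -((k : ℝ) + 1)) (b := (k : ℝ) + 1) (t₀ := 0) (fun _ _ => hF.lipschitzOnWith)
      ⟨by linarith [Nat.cast_nonneg (α := ℝ) k], by positivity⟩
      (fun t ht => ⟨hx k t ht, trivial⟩)
      (fun t ht => ⟨hx m t ⟨by linarith [ht.1], by linarith [ht.2]⟩, trivial⟩)
      (by rw [hx0, hx0]) ?_
    have := abs_le.1 ht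
    constructor <;> linarith
  -- By uniqueness the index does not matter as long as it is at least `|t|`. Taking `N` one above
  -- the ceiling makes `|t| < N` strict, so a single solution `x N` represents the glued curve near
  -- `t`.
  refine ⟨fun t => x ⌈|t|⌉₊ t, hx0 _, fun t => ?_⟩
  set N := ⌈|t|⌉₊ + 1
  have htN : |t| < N := by
    have := Nat.le_ceil |t|
    push_cast [N]
    linarith
  have heq : ∀ s : ℝ, |s| < N → x ⌈|s|⌉₊ s = x N s := fun s hs =>
    huniq _ _ (Nat.ceil_le.2 hs.le) s (Nat.le_ceil _)
  have hev : (fun s => x ⌈|s|⌉₊ s) =ᶠ[𝓝 t] x N := by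
    filter_upwards [(isOpen_lt continuous_abs continuous_const).mem_nhds htN] with s hs
    exact heq s hs
  have h1 := hx N t (by have := abs_lt.1 htN; constructor <;> linarith)
  simp only
  rw [heq t htN]
  exact h1.congr_of_eventuallyEq hev

theorem GloballyLipschitz.exists_lipschitz {nx np : ℕ} {f : Vec nx → Vec np → Vec nx}
    {Xp : Set (Vec np)} (hf : GloballyLipschitz f Xp) :
    ∃ M : NNReal, (∀ p ∈ Xp, LipschitzWith M fun x => f x p) ∧
      ∀ x, ∀ p ∈ Xp, ∀ q ∈ Xp, dist (f x p) (f x q) ≤ M * dist p q := by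
  obtain ⟨M, hM, h⟩ := hf
  lift M to NNReal using hM
  refine ⟨M, fun p hp => LipschitzWith.of_dist_le_mul fun x y => ?_, fun x p hp q hq => ?_⟩
  · simpa [dist_eq_norm, norm_join_sub_left] using h x y p hp p hp
  · simpa [dist_eq_norm, norm_join_sub_right] using h x x p hp q hq

theorem maximalInterval_eq_univ {nx np : ℕ} {f : Vec nx → Vec np → Vec nx} {Xp : Set (Vec np)}
    (hf : GloballyLipschitz f Xp) (x₀ : Vec nx) {p : Vec np} (hp : p ∈ Xp) :
    maximalInterval f p x₀ = univ := by
  obtain ⟨M, hM, -⟩ := hf.exists_lipschitz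
  obtain ⟨x, hx0, hx⟩ := exists_global_solution (hM p hp) x₀
  exact eq_univ_of_univ_subset (subset_sUnion_of_mem
    ⟨x, isOpen_univ, ordConnected_univ, mem_univ 0, hx0, fun t _ => hx t⟩)

theorem exists_isFlowMap {nx np : ℕ} {f : Vec nx → Vec np → Vec nx} {Xp : Set (Vec np)}
    (hf : GloballyLipschitz f Xp) : ∃ ψ, IsFlowMap f Xp ψ := by
  classical
  obtain ⟨M, hM, -⟩ := hf.exists_lipschitz
  choose x hx0 hx using fun (p : Vec np) (hp : p ∈ Xp) (x₀ : Vec nx) =>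
    exists_global_solution (hM p hp) x₀
  refine ⟨fun t x₀ p => if hp : p ∈ Xp then x p hp x₀ t else 0, fun x₀ p hp => ?_⟩
  rw [maximalInterval_eq_univ hf x₀ hp]
  simp only [hp, dif_pos]
  exact ⟨isOpen_univ, ordConnected_univ, mem_univ 0, hx0 p hp x₀, fun t _ => hx p hp x₀ t⟩

/-- Linearity of the Gronwall bound in `δ` and `ε` turns it into a multiple of the distance of the
data, that is, into a Lipschitz estimate. -/
theorem exists_gronwallBound_eq (K x : ℝ) :
    ∃ A, ∀ δ ε, gronwallBound δ K ε x = δ * Real.exp (K * x) + ε * A := by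
  by_cases hK : K = 0
  · exact ⟨x, fun δ ε => by simp [gronwallBound, hK]⟩
  · exact ⟨(Real.exp (K * x) - 1) / K, fun δ ε => by simp only [gronwallBound, hK, if_false]; ring⟩

/-- The flow map depends continuously on time, initial value and parameter. -/
theorem IsFlowMap.continuousOn {nx np : ℕ} {f : Vec nx → Vec np → Vec nx} {Xp : Set (Vec np)}
    (hf : GloballyLipschitz f Xp) {ψ : ℝ → Vec nx → Vec np → Vec nx} (hψ : IsFlowMap f Xp ψ)
    {T : ℝ} :
    ContinuousOn (fun q : ℝ × Vec nx × Vec np => ψ q.1 q.2.1 q.2.2) (Icc 0 T ×ˢ univ ×ˢ Xp) := by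
  obtain ⟨M, hM, hMp⟩ := hf.exists_lipschitz
  have hsol : ∀ x₀, ∀ p ∈ Xp, ψ 0 x₀ p = x₀ ∧
      ∀ t, HasDerivAt (fun t => ψ t x₀ p) (f (ψ t x₀ p) p) t := by
    intro x₀ p hp
    have h := hψ x₀ p hp
    rw [maximalInterval_eq_univ hf x₀ hp] at h
    exact ⟨h.2.2.2.1, fun t => h.2.2.2.2 t (mem_univ t)⟩
  obtain ⟨A, hA⟩ := exists_gronwallBound_eq M T
  have hlip : ∀ t ∈ Icc 0 T, LipschitzOnWith (Real.exp (M * T) + M * |A|).toNNReal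
      (fun q : Vec nx × Vec np => ψ t q.1 q.2) (univ ×ˢ Xp) := by
    intro t ht
    refine LipschitzOnWith.of_dist_le_mul fun q hq q' hq' => ?_
    rw [Real.coe_toNNReal _ (by positivity)]
    obtain ⟨h0, h⟩ := hsol q.1 q.2 hq.2
    obtain ⟨h0', h'⟩ := hsol q'.1 q'.2 hq'.2
    -- The trajectory with parameter `q'.2` is an approximate solution for the parameter `q.2`, with
    -- defect at most `M * dist q q'`.
    have h1 := dist_le_of_approx_trajectories_ODE (v := fun _ x => f x q.2) (K := M)
      (f := fun t => ψ t q.1 q.2) (f' := fun t => f (ψ t q.1 q.2) q.2)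
      (g := fun t => ψ t q'.1 q'.2) (g' := fun t => f (ψ t q'.1 q'.2) q'.2)
      (εf := 0) (εg := M * dist q q') (δ := dist q q') (a := 0) (b := T)
      (fun _ => hM _ hq.2)
      (fun t _ => (h t).continuousAt.continuousWithinAt) (fun t _ => (h t).hasDerivWithinAt)
      (fun t _ => by simp)
      (fun t _ => (h' t).continuousAt.continuousWithinAt) (fun t _ => (h' t).hasDerivWithinAt)
      (fun t _ => (hMp _ _ hq'.2 _ hq.2).trans (by
        rw [dist_comm]; gcongr; exact le_max_right _ _))
      (by simp only [h0, h0']; exact le_max_left _ _) t ht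
    refine h1.trans ((gronwallBound_mono dist_nonneg (by positivity) M.coe_nonneg
      (by linarith [ht.2] : t - 0 ≤ T)).trans ?_)
    rw [hA, zero_add]
    have : M * dist q q' * A ≤ M * dist q q' * |A| := by gcongr; exact le_abs_self A
    linarith
  refine continuousOn_prod_of_continuousOn_lipschitzOnWith' _ _ hlip ?_
  intro q hq t _
  exact ((hsol q.1 q.2 hq.2).2 t).continuousAt.continuousWithinAt

/-! ### Networks on concatenated inputs -/

theorem continuous_join {a b : ℕ} : Continuous fun q : Vec a × Vec b => join q.1 q.2 := by
  refine (PiLp.continuous_toLp 2 _).comp (continuous_pi fun i => ?_)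
  refine Fin.addCases (fun i => ?_) (fun i => ?_) i
  · simp only [Fin.append_left]; fun_prop
  · simp only [Fin.append_right]; fun_prop

theorem continuous_joinTime {a b : ℕ} :
    Continuous fun q : ℝ × Vec a × Vec b => joinTime q.1 q.2.1 q.2.2 := by
  refine (PiLp.continuous_toLp 2 _).comp (continuous_pi fun i => ?_)
  refine Fin.cases ?_ (fun i => ?_) i
  · simp only [Fin.cons_zero]; fun_prop
  · simp only [Fin.cons_succ]
    exact (continuous_apply i).comp
      ((PiLp.continuous_ofLp 2 _).comp (continuous_join.comp continuous_snd))

/-- The inverse of `join`. -/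
def split {a b : ℕ} (y : Vec (a + b)) : Vec a × Vec b :=
  (WithLp.toLp 2 fun i => y (Fin.castAdd b i), WithLp.toLp 2 fun i => y (Fin.natAdd a i))

/-- The inverse of `joinTime`. -/
def splitTime {a b : ℕ} (y : Vec (a + b + 1)) : ℝ × Vec a × Vec b :=
  (y 0, split (WithLp.toLp 2 fun i => y i.succ))

theorem continuous_split {a b : ℕ} : Continuous (split : Vec (a + b) → Vec a × Vec b) := by
  unfold split
  fun_prop

theorem continuous_splitTime {a b : ℕ} :
    Continuous (splitTime : Vec (a + b + 1) → ℝ × Vec a × Vec b) := by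
  refine Continuous.prodMk (by fun_prop) (continuous_split.comp (by fun_prop))

theorem split_join {a b : ℕ} (x : Vec a) (p : Vec b) : split (join x p) = (x, p) := by
  refine Prod.ext ?_ ?_ <;> ext i <;> simp [split, join]

theorem splitTime_joinTime {a b : ℕ} (t : ℝ) (x : Vec a) (p : Vec b) :
    splitTime (joinTime t x p) = (t, x, p) := by
  refine Prod.ext ?_ ?_
  · simp [splitTime, joinTime]
  · have : (WithLp.toLp 2 fun i : Fin (a + b) => joinTime t x p i.succ) = join x p := by
      ext i; simp [join, joinTime]
    simp only [splitTime, this, split_join]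

theorem exists_netClass_approx_join {φ : ℝ → ℝ} (hφ : IsActivation φ) {a b m : ℕ}
    {D : Set (Vec a × Vec b)} (hD : IsCompact D) {f : Vec a → Vec b → Vec m}
    (hf : ContinuousOn (fun q : Vec a × Vec b => f q.1 q.2) D) {ε : ℝ} (hε : 0 < ε) :
    ∃ N ∈ NetClass φ (a + b) m, ∀ q ∈ D, ‖f q.1 q.2 - N (join q.1 q.2)‖ ≤ ε := by
  have hc : ContinuousOn (fun y => f (split y).1 (split y).2)
      ((fun q : Vec a × Vec b => join q.1 q.2) '' D) := by
    refine hf.comp continuous_split.continuousOn ?_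
    rintro _ ⟨q, hq, rfl⟩
    simpa only [split_join] using! hq
  obtain ⟨N, hN, h⟩ := exists_netClass_approx hφ (hD.image continuous_join) hc hε
  refine ⟨N, hN, fun q hq => ?_⟩
  have := h _ ⟨q, hq, rfl⟩
  simpa only [split_join] using this

theorem exists_netClass_approx_joinTime {φ : ℝ → ℝ} (hφ : IsActivation φ) {a b m : ℕ}
    {D : Set (ℝ × Vec a × Vec b)} (hD : IsCompact D) {f : ℝ → Vec a → Vec b → Vec m}
    (hf : ContinuousOn (fun q : ℝ × Vec a × Vec b => f q.1 q.2.1 q.2.2) D) {ε : ℝ} (hε : 0 < ε) :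
    ∃ N ∈ NetClass φ (a + b + 1) m, ∀ q ∈ D,
      ‖f q.1 q.2.1 q.2.2 - N (joinTime q.1 q.2.1 q.2.2)‖ ≤ ε := by
  have hc : ContinuousOn (fun y => f (splitTime y).1 (splitTime y).2.1 (splitTime y).2.2)
      ((fun q : ℝ × Vec a × Vec b => joinTime q.1 q.2.1 q.2.2) '' D) := by
    refine hf.comp continuous_splitTime.continuousOn ?_
    rintro _ ⟨q, hq, rfl⟩
    simpa only [splitTime_joinTime] using! hq
  obtain ⟨N, hN, h⟩ := exists_netClass_approx hφ (hD.image continuous_joinTime) hc hε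
  refine ⟨N, hN, fun q hq => ?_⟩
  have := h _ ⟨q, hq, rfl⟩
  simpa only [splitTime_joinTime] using this

/-- A network approximation that does not vanish at a prescribed point. -/
theorem exists_netClass_approx_joinTime_ne_zero {φ : ℝ → ℝ} (hφ : IsActivation φ) {a b m : ℕ}
    (hm : 0 < m) {D : Set (ℝ × Vec a × Vec b)} (hD : IsCompact D) {f : ℝ → Vec a → Vec b → Vec m}
    (hf : ContinuousOn (fun q : ℝ × Vec a × Vec b => f q.1 q.2.1 q.2.2) D) {ε : ℝ} (hε : 0 < ε)
    (q₀ : ℝ × Vec a × Vec b) :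
    ∃ N ∈ NetClass φ (a + b + 1) m, N (joinTime q₀.1 q₀.2.1 q₀.2.2) ≠ 0 ∧ ∀ q ∈ D,
      ‖f q.1 q.2.1 q.2.2 - N (joinTime q.1 q.2.1 q.2.2)‖ ≤ ε := by
  obtain ⟨N, hN, h⟩ := exists_netClass_approx_joinTime hφ hD hf (half_pos hε)
  by_cases h0 : N (joinTime q₀.1 q₀.2.1 q₀.2.2) = 0
  -- Shifting the output bias by a vector of norm `ε / 2` moves the value off zero and uses up the
  -- other half of the tolerance.
  · set κ : Vec m := EuclideanSpace.single ⟨0, hm⟩ (ε / 2)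
    have hκ : ‖κ‖ = ε / 2 := by
      rw [PiLp.norm_single, Real.norm_of_nonneg (by positivity)]
    refine ⟨_, add_const_mem_netClass hN κ, ?_, fun q hq => ?_⟩
    · rw [h0, zero_add, ← norm_pos_iff, hκ]
      positivity
    · rw [← sub_sub]
      refine (norm_sub_le _ _).trans ?_
      rw [hκ]
      linarith [h q hq]
  · exact ⟨N, hN, h0, fun q hq => (h q hq).trans (by linarith)⟩

/-! ### Decompositions and the error estimate -/

/-- The norm of `v.ofLp` is the sup norm; this mixed bound is why `c₁` and `c₂` are suprema of sup
norms. -/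
theorem norm_hadamard_le {m : ℕ} (u v : Vec m) : ‖hadamard u v‖ ≤ ‖u‖ * ‖v.ofLp‖ := by
  rw [EuclideanSpace.norm_eq, EuclideanSpace.norm_eq]
  refine Real.sqrt_le_iff.2 ⟨by positivity, ?_⟩
  rw [mul_pow, Real.sq_sqrt (by positivity), Finset.sum_mul]
  refine Finset.sum_le_sum fun i _ => ?_
  rw [← mul_pow, hadamard, norm_mul]
  gcongr
  exact norm_le_pi_norm v.ofLp i

theorem continuous_hadamard {m : ℕ} : Continuous fun q : Vec m × Vec m => hadamard q.1 q.2 := by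
  unfold hadamard
  fun_prop

theorem isLatentSolution_latentState {m : ℕ} (v y₀ : Vec m) :
    IsLatentSolution v y₀ (latentState y₀ v) := by
  refine ⟨by ext i; simp [latentState, hadamard], fun s i => ?_⟩
  have h : HasDerivAt (fun r : ℝ => y₀ i + r * v i) (1 * v i) (s i) :=
    ((hasDerivAt_id (s i)).mul_const (v i)).const_add (y₀ i)
  rw [one_mul] at h
  simpa [latentState, hadamard] using h

/-- Pad by zeros, invert by truncation, and let `h` carry the whole padded flow, with `g = 0` and `b
= 1`. -/
theorem exists_isDecomposition {nx np m : ℕ} (hm : nx ≤ m) {T : ℝ} {G₀ : Set (Vec nx)}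
    {Xp : Set (Vec np)} {ψ : ℝ → Vec nx → Vec np → Vec nx}
    (hψ : ContinuousOn (fun q : ℝ × Vec nx × Vec np => ψ q.1 q.2.1 q.2.2)
      (Icc 0 T ×ˢ G₀ ×ˢ Xp)) :
    ∃ (l : Vec nx → Vec m) (linv : Vec m → Vec nx) (g b : Vec nx → Vec np → Vec m)
      (h : ℝ → Vec nx → Vec np → Vec m), IsDecomposition T G₀ Xp ψ l linv g b h := by
  let l : Vec nx → Vec m := fun x =>
    WithLp.toLp 2 fun i => if hi : (i : ℕ) < nx then x ⟨i, hi⟩ else 0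
  let linv : Vec m → Vec nx := fun y => WithLp.toLp 2 fun i => y (Fin.castLE hm i)
  have hl : Continuous l := by
    refine (PiLp.continuous_toLp 2 _).comp (continuous_pi fun i => ?_)
    by_cases hi : (i : ℕ) < nx
    · simp only [hi, dif_pos]; fun_prop
    · simp only [hi, dif_neg, not_false_eq_true]; fun_prop
  have hinv : Function.LeftInverse linv l := fun x => by ext i; simp [l, linv]
  have hone : ∀ y : Vec m, 0 + hadamard y (WithLp.toLp 2 fun _ => 1) = y := fun y => by
    ext i; simp [hadamard]
  refine ⟨l, linv, fun _ _ => 0, fun _ _ => WithLp.toLp 2 fun _ => 1,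
    fun t x p => l (ψ t x p), hl, hinv, ?_, continuousOn_const, continuousOn_const, ?_,
    hl.comp_continuousOn hψ, ?_, ?_⟩
  · have : Continuous linv := by simp only [linv]; fun_prop
    exact this.continuousOn
  · intro x _ p _ i
    simp
  · intro t _ x _ p _
    rw [hone]
    exact mem_range_self _
  · intro t _ x _ p _
    rw [hone, hinv]

theorem exists_isLUB_image {X : Type*} [TopologicalSpace X] {D : Set X} (hD : IsCompact D)
    (hne : D.Nonempty) {g : X → ℝ} (hg : ContinuousOn g D) : ∃ c, IsLUB (g '' D) c :=
  ⟨_, (hD.image_of_continuousOn hg).isLUB_sSup (hne.image g)⟩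

theorem norm_eq_zero_of_dim_eq_zero {m : ℕ} (hm : m = 0) (v : Vec m) : ‖v‖ = 0 := by
  subst hm
  rw [Subsingleton.elim v 0, norm_zero]

/-- The case `c = 0` occurs for `m = 0`, where division by zero gives `0`; hence an inequality. -/
theorem mul_div_mul_le {ε L c : ℝ} (hε : 0 ≤ ε) (hL : 0 < L) (hc : 0 ≤ c) :
    L * (ε / (4 * L * c) * c) ≤ ε / 4 := by
  rcases hc.eq_or_lt with rfl | hc
  · simpa using by positivity
  · apply le_of_eq
    field_simp

/-- The approximation of a decomposed flow map by networks. -/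
theorem IsDecomposition.exists_networks {nx np m : ℕ} {T : ℝ} (hT : 0 ≤ T) {G₀ : Set (Vec nx)}
    (hG₀ : IsCompact G₀) (hG₀_ne : G₀.Nonempty) {Xp : Set (Vec np)} (hXp : IsCompact Xp)
    (hXp_ne : Xp.Nonempty) {φ : ℝ → ℝ} (hφ : IsActivation φ)
    {ψ : ℝ → Vec nx → Vec np → Vec nx} {l : Vec nx → Vec m} {linv : Vec m → Vec nx}
    {g b : Vec nx → Vec np → Vec m} {h : ℝ → Vec nx → Vec np → Vec m}
    (hdec : IsDecomposition T G₀ Xp ψ l linv g b h) {ε : ℝ} (hε : 0 < ε) :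
    ∃ d ∈ NetClass φ m nx, ∃ e ∈ NetClass φ (nx + np) m, ∃ c ∈ NetClass φ (nx + np) m,
    ∃ τ ∈ NetClass φ (nx + np + 1) m,
      (∀ t ∈ Icc 0 T, ∀ x₀ ∈ G₀, ∀ p ∈ Xp,
        ‖ψ t x₀ p - d (latentState (e (join x₀ p)) (c (join x₀ p)) (τ (joinTime t x₀ p)))‖ ≤ ε) ∧
      ∃ (L : NNReal) (c₁ c₂ : ℝ), 0 < L ∧ LipschitzWith L d ∧
        IsLUB {r : ℝ | ∃ x₀ ∈ G₀, ∃ p ∈ Xp, r = ‖(b x₀ p).ofLp‖} c₁ ∧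
        IsLUB {r : ℝ | ∃ t ∈ Icc 0 T, ∃ x₀ ∈ G₀, ∃ p ∈ Xp,
          r = ‖(τ (joinTime t x₀ p)).ofLp‖} c₂ ∧
        (0 < m → 0 < c₁ ∧ 0 < c₂) ∧
        (∀ t ∈ Icc 0 T, ∀ x₀ ∈ G₀, ∀ p ∈ Xp,
          ‖linv (g x₀ p + hadamard (h t x₀ p) (b x₀ p))
            - d (g x₀ p + hadamard (h t x₀ p) (b x₀ p))‖ ≤ ε / 4) ∧
        (∀ x₀ ∈ G₀, ∀ p ∈ Xp, ‖g x₀ p - e (join x₀ p)‖ ≤ ε / (4 * L)) ∧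
        (∀ x₀ ∈ G₀, ∀ p ∈ Xp, ‖b x₀ p - c (join x₀ p)‖ ≤ ε / (4 * L * c₂)) ∧
        (∀ t ∈ Icc 0 T, ∀ x₀ ∈ G₀, ∀ p ∈ Xp,
          ‖h t x₀ p - τ (joinTime t x₀ p)‖ ≤ ε / (4 * L * c₁)) := by
  obtain ⟨x', hx'⟩ := hG₀_ne
  obtain ⟨p', hp'⟩ := hXp_ne
  have h0T : (0 : ℝ) ∈ Icc 0 T := ⟨le_rfl, hT⟩
  have hD : IsCompact (G₀ ×ˢ Xp) := hG₀.prod hXp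
  have hE : IsCompact (Icc 0 T ×ˢ G₀ ×ˢ Xp) := isCompact_Icc.prod hD
  obtain ⟨C, hL⟩ := hφ.2.1
  -- the decoder
  have hycont : ContinuousOn (fun q : ℝ × Vec nx × Vec np =>
      g q.2.1 q.2.2 + hadamard (h q.1 q.2.1 q.2.2) (b q.2.1 q.2.2)) (Icc 0 T ×ˢ G₀ ×ˢ Xp) := by
    have hsnd : MapsTo Prod.snd (Icc 0 T ×ˢ G₀ ×ˢ Xp) (G₀ ×ˢ Xp) := fun q hq => hq.2
    exact (hdec.continuousOn_g.comp continuousOn_snd hsnd).add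
      (continuous_hadamard.comp_continuousOn
        (hdec.continuousOn_h.prodMk (hdec.continuousOn_b.comp continuousOn_snd hsnd)))
  -- `d` approximates `linv` only on the compact set of exact latent states. The perturbed states
  -- may leave `range l`; there only the global Lipschitz bound of `d` is used.
  obtain ⟨d, hd, hdapprox⟩ := exists_netClass_approx hφ (hE.image_of_continuousOn hycont)
    (hdec.continuousOn_linv.mono (by
      rintro _ ⟨q, hq, rfl⟩
      exact hdec.mem_range _ hq.1 _ hq.2.1 _ hq.2.2)) (ε := ε / 4) (by positivity)
  obtain ⟨L₀, hdL₀⟩ := exists_lipschitzWith_of_mem_netClass hL hd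
  -- Enlarging the constant by `1` makes it positive, so that it can stand in denominators.
  obtain ⟨L, hLpos, hdL⟩ : ∃ L : NNReal, 0 < L ∧ LipschitzWith L d :=
    ⟨L₀ + 1, by positivity, hdL₀.weaken (by simp)⟩
  have hLpos' : (0 : ℝ) < L := hLpos
  -- the encoder
  obtain ⟨e, he, heapprox⟩ := exists_netClass_approx_join hφ hD hdec.continuousOn_g
    (ε := ε / (4 * L)) (by positivity)
  -- the time transformation
  obtain ⟨c₁, hc₁⟩ := exists_isLUB_image hD ⟨(x', p'), hx', hp'⟩
    (((PiLp.continuous_ofLp 2 _).comp_continuousOn hdec.continuousOn_b).norm)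
  have hbc₁ : ∀ x ∈ G₀, ∀ p ∈ Xp, ‖(b x p).ofLp‖ ≤ c₁ := fun x hx p hp =>
    hc₁.1 ⟨(x, p), ⟨hx, hp⟩, rfl⟩
  have hc₁0 : 0 ≤ c₁ := (norm_nonneg _).trans (hbc₁ x' hx' p' hp')
  have hc₁pos : 0 < m → 0 < c₁ := fun hm =>
    (norm_pos_iff.2 fun h0 => hdec.b_ne_zero x' hx' p' hp' ⟨0, hm⟩ (congrFun h0 _)).trans_le
      (hbc₁ x' hx' p' hp')
  -- For `m > 0`, a `τ` that is nonzero at one point of `E` has `c₂ > 0`, so the tolerance required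
  -- of `c` is positive.
  obtain ⟨τ, hτ, hτ0, hτapprox⟩ : ∃ τ ∈ NetClass φ (nx + np + 1) m,
      (0 < m → τ (joinTime 0 x' p') ≠ 0) ∧ ∀ q ∈ Icc 0 T ×ˢ G₀ ×ˢ Xp,
        ‖h q.1 q.2.1 q.2.2 - τ (joinTime q.1 q.2.1 q.2.2)‖ ≤ ε / (4 * L * c₁) := by
    rcases m.eq_zero_or_pos with hm | hm
    · obtain ⟨τ, hτ, -⟩ := exists_netClass_approx_joinTime hφ hE hdec.continuousOn_h one_pos
      refine ⟨τ, hτ, fun h => absurd hm h.ne', fun q _ => ?_⟩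
      rw [norm_eq_zero_of_dim_eq_zero hm]
      positivity
    · have := hc₁pos hm
      obtain ⟨τ, hτ, h0, h1⟩ := exists_netClass_approx_joinTime_ne_zero hφ hm hE
        hdec.continuousOn_h (ε := ε / (4 * L * c₁)) (by positivity) (0, x', p')
      exact ⟨τ, hτ, fun _ => h0, h1⟩
  obtain ⟨Lτ, hLτ⟩ := exists_lipschitzWith_of_mem_netClass hL hτ
  -- the velocity
  obtain ⟨c₂, hc₂⟩ := exists_isLUB_image hE ⟨(0, x', p'), h0T, hx', hp'⟩
    ((PiLp.continuous_ofLp 2 _).comp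
      (hLτ.continuous.comp (continuous_joinTime (a := nx) (b := np)))).norm.continuousOn
  have hτc₂ : ∀ t ∈ Icc 0 T, ∀ x ∈ G₀, ∀ p ∈ Xp, ‖(τ (joinTime t x p)).ofLp‖ ≤ c₂ :=
    fun t ht x hx p hp => hc₂.1 ⟨(t, x, p), ⟨ht, hx, hp⟩, rfl⟩
  have hc₂0 : 0 ≤ c₂ := (norm_nonneg _).trans (hτc₂ 0 h0T x' hx' p' hp')
  have hc₂pos : 0 < m → 0 < c₂ := fun hm =>
    (norm_pos_iff.2 fun h0 => hτ0 hm (by ext i; exact congrFun h0 i)).trans_le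
      (hτc₂ 0 h0T x' hx' p' hp')
  obtain ⟨c, hc, hcapprox⟩ : ∃ c ∈ NetClass φ (nx + np) m, ∀ q ∈ G₀ ×ˢ Xp,
      ‖b q.1 q.2 - c (join q.1 q.2)‖ ≤ ε / (4 * L * c₂) := by
    rcases m.eq_zero_or_pos with hm | hm
    · obtain ⟨c, hc, -⟩ := exists_netClass_approx_join hφ hD hdec.continuousOn_b one_pos
      refine ⟨c, hc, fun q _ => ?_⟩
      rw [norm_eq_zero_of_dim_eq_zero hm]
      positivity
    · have := hc₂pos hm
      exact exists_netClass_approx_join hφ hD hdec.continuousOn_b (by positivity)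
  refine ⟨d, hd, e, he, c, hc, τ, hτ, fun t ht x hx p hp => ?_, L, c₁, c₂, hLpos, hdL, ?_, ?_,
    fun hm => ⟨hc₁pos hm, hc₂pos hm⟩,
    fun t ht x hx p hp => hdapprox _ ⟨(t, x, p), ⟨ht, hx, hp⟩, rfl⟩,
    fun x hx p hp => heapprox (x, p) ⟨hx, hp⟩, fun x hx p hp => hcapprox (x, p) ⟨hx, hp⟩,
    fun t ht x hx p hp => hτapprox (t, x, p) ⟨ht, hx, hp⟩⟩
  · rw [hdec.eq_flow t ht x hx p hp]
    have h1 : ‖linv (g x p + hadamard (h t x p) (b x p)) -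
        d (g x p + hadamard (h t x p) (b x p))‖ ≤ ε / 4 :=
      hdapprox _ ⟨(t, x, p), ⟨ht, hx, hp⟩, rfl⟩
    have h2 : ‖g x p - e (join x p)‖ ≤ ε / (4 * L) := heapprox (x, p) ⟨hx, hp⟩
    have h3 : ‖b x p - c (join x p)‖ ≤ ε / (4 * L * c₂) := hcapprox (x, p) ⟨hx, hp⟩
    have h4 : ‖h t x p - τ (joinTime t x p)‖ ≤ ε / (4 * L * c₁) :=
      hτapprox (t, x, p) ⟨ht, hx, hp⟩
    set E := e (join x p)
    set V := c (join x p)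
    set S := τ (joinTime t x p)
    -- Splitting through `τ ∘ b` leaves `b` and `τ` as factors, whose bounds `c₁` and `c₂` are known
    -- before `c` is chosen.
    have h5 : g x p + hadamard (h t x p) (b x p) - latentState E V S =
        (g x p - E) + hadamard (h t x p - S) (b x p) + hadamard (b x p - V) S := by
      ext i
      simp only [latentState, hadamard, PiLp.add_apply, PiLp.sub_apply]
      ring
    have h6 : ‖hadamard (h t x p - S) (b x p)‖ ≤ ε / (4 * L * c₁) * c₁ :=
      (norm_hadamard_le _ _).trans (mul_le_mul h4 (hbc₁ x hx p hp) (norm_nonneg _) (by positivity))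
    have h7 : ‖hadamard (b x p - V) S‖ ≤ ε / (4 * L * c₂) * c₂ :=
      (norm_hadamard_le _ _).trans
        (mul_le_mul h3 (hτc₂ t ht x hx p hp) (norm_nonneg _) (by positivity))
    have h8 := hdL.dist_le_mul (g x p + hadamard (h t x p) (b x p)) (latentState E V S)
    rw [dist_eq_norm, dist_eq_norm, h5] at h8
    have h9 : (L : ℝ) * ‖(g x p - E) + hadamard (h t x p - S) (b x p) + hadamard (b x p - V) S‖ ≤
        L * (ε / (4 * L) + ε / (4 * L * c₁) * c₁ + ε / (4 * L * c₂) * c₂) := by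
      gcongr
      exact norm_add₃_le.trans (add_le_add (add_le_add h2 h6) h7)
    have h10 : (L : ℝ) * (ε / (4 * L)) = ε / 4 := by field_simp
    have h11 := mul_div_mul_le hε.le hLpos' hc₁0
    have h12 := mul_div_mul_le hε.le hLpos' hc₂0
    have h13 := norm_sub_le_norm_sub_add_norm_sub (linv (g x p + hadamard (h t x p) (b x p)))
      (d (g x p + hadamard (h t x p) (b x p))) (d (latentState E V S))
    linarith
  · convert hc₁ using 1
    ext r
    constructor
    · rintro ⟨x, hx, p, hp, rfl⟩
      exact ⟨(x, p), ⟨hx, hp⟩, rfl⟩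
    · rintro ⟨q, hq, rfl⟩
      exact ⟨q.1, hq.1, q.2, hq.2, rfl⟩
  · convert hc₂ using 1
    ext r
    constructor
    · rintro ⟨t, ht, x, hx, p, hp, rfl⟩
      exact ⟨(t, x, p), ⟨ht, hx, hp⟩, rfl⟩
    · rintro ⟨q, hq, rfl⟩
      exact ⟨q.1, hq.1, q.2.1, hq.2.1, q.2.2, hq.2.2, rfl⟩

end LiLaN

theorem mainTheorem1 {nx np : ℕ} (f : LiLaN.Vec nx → LiLaN.Vec np → LiLaN.Vec nx)
    (Xp : Set (LiLaN.Vec np)) (hXp : IsCompact Xp) (hXp_ne : Xp.Nonempty)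
    (hf : LiLaN.GloballyLipschitz f Xp)
    (G₀ : Set (LiLaN.Vec nx)) (hG₀ : IsCompact G₀) (hG₀_ne : G₀.Nonempty)
    (T : ℝ) (hT : 0 < T)
    (φ : ℝ → ℝ) (hφ : LiLaN.IsActivation φ) :
    -- every solution exists for all times, and the flow map exists
    (∀ x₀ : LiLaN.Vec nx, ∀ p ∈ Xp, LiLaN.maximalInterval f p x₀ = univ) ∧
    (∃ ψ : ℝ → LiLaN.Vec nx → LiLaN.Vec np → LiLaN.Vec nx, LiLaN.IsFlowMap f Xp ψ) ∧
    ∀ ψ : ℝ → LiLaN.Vec nx → LiLaN.Vec np → LiLaN.Vec nx, LiLaN.IsFlowMap f Xp ψ →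
    ∀ m : ℕ, nx ≤ m →
      -- the flow map admits a decomposition with latent dimension `m`
      (∃ (l : LiLaN.Vec nx → LiLaN.Vec m) (linv : LiLaN.Vec m → LiLaN.Vec nx)
        (g b : LiLaN.Vec nx → LiLaN.Vec np → LiLaN.Vec m)
        (h : ℝ → LiLaN.Vec nx → LiLaN.Vec np → LiLaN.Vec m),
        LiLaN.IsDecomposition T G₀ Xp ψ l linv g b h) ∧
      -- and for every such decomposition and every accuracy there are suitable networks
      ∀ (l : LiLaN.Vec nx → LiLaN.Vec m) (linv : LiLaN.Vec m → LiLaN.Vec nx)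
        (g b : LiLaN.Vec nx → LiLaN.Vec np → LiLaN.Vec m)
        (h : ℝ → LiLaN.Vec nx → LiLaN.Vec np → LiLaN.Vec m),
        LiLaN.IsDecomposition T G₀ Xp ψ l linv g b h →
      ∀ ε : ℝ, 0 < ε →
      ∃ d ∈ LiLaN.NetClass φ m nx,
      ∃ e ∈ LiLaN.NetClass φ (nx + np) m,
      ∃ c ∈ LiLaN.NetClass φ (nx + np) m,
      ∃ τ ∈ LiLaN.NetClass φ (nx + np + 1) m,
        -- the latent dynamics with velocity `c` and initial value `e`
        (∀ x₀ ∈ G₀, ∀ p ∈ Xp,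
          LiLaN.IsLatentSolution (c (LiLaN.join x₀ p)) (e (LiLaN.join x₀ p))
            (LiLaN.latentState (e (LiLaN.join x₀ p)) (c (LiLaN.join x₀ p)))) ∧
        -- the uniform approximation of the flow map
        (∀ t ∈ Icc 0 T, ∀ x₀ ∈ G₀, ∀ p ∈ Xp,
          ‖ψ t x₀ p - d (LiLaN.latentState (e (LiLaN.join x₀ p)) (c (LiLaN.join x₀ p))
            (τ (LiLaN.joinTime t x₀ p)))‖ ≤ ε) ∧
        -- the approximation property of each single network
        ∃ (L : NNReal) (c₁ c₂ : ℝ), 0 < L ∧ LipschitzWith L d ∧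
          IsLUB {r : ℝ | ∃ x₀ ∈ G₀, ∃ p ∈ Xp, r = ‖(b x₀ p).ofLp‖} c₁ ∧
          IsLUB {r : ℝ | ∃ t ∈ Icc 0 T, ∃ x₀ ∈ G₀, ∃ p ∈ Xp,
            r = ‖(τ (LiLaN.joinTime t x₀ p)).ofLp‖} c₂ ∧
          (0 < m → 0 < c₁ ∧ 0 < c₂) ∧
          (∀ t ∈ Icc 0 T, ∀ x₀ ∈ G₀, ∀ p ∈ Xp,
            ‖linv (g x₀ p + LiLaN.hadamard (h t x₀ p) (b x₀ p))
              - d (g x₀ p + LiLaN.hadamard (h t x₀ p) (b x₀ p))‖ ≤ ε / 4) ∧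
          (∀ x₀ ∈ G₀, ∀ p ∈ Xp, ‖g x₀ p - e (LiLaN.join x₀ p)‖ ≤ ε / (4 * L)) ∧
          (∀ x₀ ∈ G₀, ∀ p ∈ Xp, ‖b x₀ p - c (LiLaN.join x₀ p)‖ ≤ ε / (4 * L * c₂)) ∧
          (∀ t ∈ Icc 0 T, ∀ x₀ ∈ G₀, ∀ p ∈ Xp,
            ‖h t x₀ p - τ (LiLaN.joinTime t x₀ p)‖ ≤ ε / (4 * L * c₁)) := by
  refine ⟨fun x₀ p hp => LiLaN.maximalInterval_eq_univ hf x₀ hp, LiLaN.exists_isFlowMap hf,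
    fun ψ hψ m hm => ⟨?_, fun l linv g b h hdec ε hε => ?_⟩⟩
  · exact LiLaN.exists_isDecomposition hm ((hψ.continuousOn hf).mono
      (prod_mono_right (prod_mono_left (subset_univ _))))
  · obtain ⟨d, hd, e, he, c, hc, τ, hτ, h1, h2⟩ :=
      hdec.exists_networks hT.le hG₀ hG₀_ne hXp hXp_ne hφ hε
    exact ⟨d, hd, e, he, c, hc, τ, hτ,
      fun _ _ _ _ => LiLaN.isLatentSolution_latentState _ _, h1, h2⟩
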